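/- **Theorem (polynomial margin bounds fail for the linear problem).** *Setting.* For a unit vector $\mu\in\mathbb R^d$ and $\sigma>0$ let $\mathcal D_{\mu,\sigma,d}$ be the law of $(x,y)\in\mathbb R^d\times\{-1,1\}$, where $y$ is a uniform sign, $x=y\mu+\xi$, and $\xi$ is independent of $y$ and uniform on the sphere of radius $\sqrt{d-1}\,\sigma$ in the hyperplane $\mu^\perp$. Let $\Omega_{\sigma,d}=\{\mathcal D_{\mu,\sigma,d}:\|\mu\|=1\}$ and $\kappa=\frac{n}{d\sigma^2}$. A weight vector $w\in\mathbb R^d$ gives the classifier $f_w(x)=w^Tx$. Let $\mathcal L_{\mathcal D}(f_w)$ and $\mathcal L_S(f_w)$ be the test loss and the empirical loss for the $0/1$ loss $\mathbf 1(\operatorname{sign} f_w(x)\ne y)$. For a sample $S=((x_i,y_i))_{i\le n}$ put $\gamma(f_w,S)=\min_i y_if_w(x_i)$ and $\gamma^*(S)=\sup_{\|w\|\le1}\gamma(f_w,S)$. A vector $w$ with $\|w\|\le 1$ is a $(1-\epsilon)$-max-margin solution for $S$ if $\gamma(f_w,S)\ge(1-\epsilon)\gamma^*(S)$. *Claim.*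 There is a universal constant $c>0$ such that the following holds for all $n,d,\sigma$ with $0<\kappa<1$ and $\frac dn\ge\frac{c}{\kappa^2(1-\kappa)^4}$. Let $\epsilon=\frac{\kappa(1-\kappa)^2}{c}$, and let $\mathcal A$ be any (measurable) algorithm whose output $\mathcal A(S)$ is a $(1-\epsilon)$-max-margin solution for every $S\in(\mathbb R^d\times\{-1,1\})^n$. Let $\mathcal H$ be any (measurable) class of weight vectors that is useful for $\mathcal A$, that is, $\Pr_{S\sim\mathcal D^n}[\mathcal A(S)\in\mathcal H]\ge\frac34$ for every $\mathcal D\in\Omega_{\sigma,d}$. Let $p\ge1$ be an integer and let $G$ be a real number such that $G/\gamma^p$ is a polynomial margin bound of degree $p$ for $\Omega_{\sigma,d}$, that is, for every $\mathcal D\in\Omega_{\sigma,d}$, $$\Pr_{S\sim\mathcal D^n}\Big[\exists\, w\in\mathcal H:\ \gamma(f_w,S)>0\ \text{ and }\ \mathcal L_{\mathcal D}(f_w)-\mathcal L_S(f_w)\ge\frac{G}{\gamma(f_w,S)^p}\Big]\le\frac14 .$$ Then for every $\mathcal D\in\Omega_{\sigma,d}$, with probability at least $\frac12-3e^{-n}$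 over $S\sim\mathcal D^n$, the bound is weak even on the max-margin solution: $$\frac{G}{\gamma^*(S)^p}\ \ge\ \max\Big(\frac1c,\ 1-e^{-\kappa/(36\sigma^2)}-e^{-n/8}-3\kappa\Big)^p .$$ -/

import Mathlib

open MeasureTheory

/-- The feature space `ℝ^d` with the Euclidean norm. -/
abbrev Feat (d : ℕ) := EuclideanSpace ℝ (Fin d)

/-- A labelled example `(x, y) ∈ ℝ^d × {-1, 1}`. The label set `{-1, 1}` is `ℤˣ`. -/
abbrev Example (d : ℕ) := Feat d × ℤˣ

/-- The label as a real number. -/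
def labelVal (y : ℤˣ) : ℝ := ((y : ℤ) : ℝ)

/-- The linear model `f_w(x) = wᵀ x`. -/
noncomputable def linPred {d : ℕ} (w x : Feat d) : ℝ := inner ℝ w x

/-- The uniform probability measure on the unit sphere of the hyperplane `μ^⊥`: the surface
measure of that sphere, normalized to total mass one. -/
noncomputable def unitSphereLaw {d : ℕ} (μ : Feat d) :
    Measure (Metric.sphere (0 : (Submodule.span ℝ {μ})ᗮ) 1) :=
  ((Measure.addHaar : Measure (Submodule.span ℝ {μ})ᗮ).toSphere Set.univ)⁻¹ •
    (Measure.addHaar : Measure (Submodule.span ℝ {μ})ᗮ).toSphere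

/-- The law of the junk component `ξ`: uniform on the sphere of radius `√(d - 1) σ` in the
`d - 1` dimensions orthogonal to `μ`. -/
noncomputable def junkLaw {d : ℕ} (μ : Feat d) (σ : ℝ) : Measure (Feat d) :=
  (unitSphereLaw μ).map
    (fun u : Metric.sphere (0 : (Submodule.span ℝ {μ})ᗮ) 1 =>
      (Real.sqrt ((d : ℝ) - 1) * σ) • ((u : (Submodule.span ℝ {μ})ᗮ) : Feat d))

/-- The uniform law on the labels `{-1, 1}`. -/
noncomputable def labelLaw : Measure ℤˣ :=
  (2⁻¹ : ENNReal) • Measure.dirac 1 + (2⁻¹ : ENNReal) • Measure.dirac (-1)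

/-- The distribution `D_{μ,σ,d}` of `(x, y)`: `x = y μ + ξ` with `y` a uniform label and `ξ`
an independent junk component. -/
noncomputable def linDist {d : ℕ} (μ : Feat d) (σ : ℝ) : Measure (Example d) :=
  (labelLaw.prod (junkLaw μ σ)).map (fun q => (labelVal q.1 • μ + q.2, q.1))

/-- The linear problem class `Ω_{σ,d} = {D_{μ,σ,d} : ‖μ‖ = 1}`. -/
def linearClass (σ : ℝ) (d : ℕ) : Set (Measure (Example d)) :=
  {D | ∃ μ : Feat d, ‖μ‖ = 1 ∧ D = linDist μ σ}

/-- A sample of `n` labelled examples. -/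
abbrev Sample (n d : ℕ) := Fin n → Example d

/-- The law `D^n` of `n` independent examples. -/
noncomputable def sampleLaw {d : ℕ} (n : ℕ) (D : Measure (Example d)) : Measure (Sample n d) :=
  Measure.pi (fun _ => D)

/-- The `0/1` loss: one if and only if the signs disagree (`sign 0 = 0`). -/
noncomputable def zeroOneLoss (a b : ℝ) : ℝ :=
  if SignType.sign a = SignType.sign b then 0 else 1

/-- The test loss `L_D(f_w)`. -/
noncomputable def testLoss {d : ℕ} (D : Measure (Example d)) (w : Feat d) : ℝ :=
  ∫ z, zeroOneLoss (linPred w z.1) (labelVal z.2) ∂D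

/-- The empirical loss `L_S(f_w)`. -/
noncomputable def empLoss {n d : ℕ} (S : Sample n d) (w : Feat d) : ℝ :=
  (n : ℝ)⁻¹ * ∑ i, zeroOneLoss (linPred w (S i).1) (labelVal (S i).2)

/-- The margin `γ(f_w, S) = min_i y_i f_w(x_i)`. -/
noncomputable def margin {n d : ℕ} (w : Feat d) (S : Sample n d) : ℝ :=
  ⨅ i, labelVal (S i).2 * linPred w (S i).1

/-- The maximum margin `γ*(S) = sup_{‖w‖ ≤ 1} γ(f_w, S)`. -/
noncomputable def maxMargin {n d : ℕ} (S : Sample n d) : ℝ :=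
  ⨆ w : Metric.closedBall (0 : Feat d) 1, margin (w : Feat d) S

/-- `w` is a `(1 - ε)`-max-margin solution for `S`: it lies in the unit ball over which `γ*(S)`
is the maximum, and attains at least the fraction `1 - ε` of `γ*(S)`. -/
def IsNearMaxMargin {n d : ℕ} (ε : ℝ) (w : Feat d) (S : Sample n d) : Prop :=
  ‖w‖ ≤ 1 ∧ (1 - ε) * maxMargin S ≤ margin w S

/-- The class `H` of linear classifiers (given by their weight vectors) is useful with respect to
the algorithm `A` over the problem class `Ω`. -/
def IsUseful {n d : ℕ} (A : Sample n d → Feat d) (H : Set (Feat d))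
    (Ω : Set (Measure (Example d))) : Prop :=
  ∀ D ∈ Ω, 3 / 4 ≤ sampleLaw n D {S | A S ∈ H}

/-- `G / γ^p` is a degree-`p` polynomial margin bound over `H` for the problem class `Ω` and samples
of size `n`: for each `D ∈ Ω`, the probability that the generalization gap of some `w ∈ H` (with
positive margin, so that the bound is meaningful) reaches `G / γ(f_w, S)^p` is at most `1/4`. -/
def IsPolyMarginBound {d : ℕ} (n : ℕ) (H : Set (Feat d)) (Ω : Set (Measure (Example d)))
    (p : ℕ) (G : ℝ) : Prop :=
  ∀ D ∈ Ω, sampleLaw n D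
    {S | ∃ w ∈ H, 0 < margin w S ∧ G / margin w S ^ p ≤ testLoss D w - empLoss S w} ≤ 1 / 4

/-! The number `G` has to serve every signal direction at once, and a classifier of nearly maximal
margin owes most of its margin to the junk, not to the signal. Replacing the signal while keeping
labels and junk therefore produces a sample of another distribution in the class, on which the same
classifier still has a large margin but classifies fresh data badly. If `G` were small, this would
break the margin bound with probability above `1/4`.

Let `T = marginScale κ`, so `T²` is about `1 + 1/κ`. A margin is a minimum, hence at most the inner
product with the labelled mean `g = μ + n⁻¹ ∑ yᵢ ξᵢ`, whose norm is typically at most `T`.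
Conversely, dual vectors of the nearly orthogonal junk give a short `W` with `yᵢ⟪W, ξᵢ⟫ = 1`, and a
combination of `μ` and `W` has margin about `T` (`sqrt_le_maxMargin`). Both estimates hold outside
probability `1/8`, by second and fourth moments of the junk and the variance of a Rademacher sum
(`labels_junks_bad_le`). So a near-maximizer `w` is close to `g / T` (`abs_inner_sub_le`); in
particular `⟪w, μ⟫` is about `1/T`, and `⟪w, e⟫` is about `0` for unit `e` orthogonal to `μ` and the
junk. Changing the signal shifts all margins by one common amount (`margin_mkSample_sub_le`).

Two replacements are used. With `-μ`, for `κ < 1/3`, the margin stays above `(1 - 3κ) T` and the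
test loss is at least `1 - exp(-κ/(36σ²))`, by a spherical cap bound; the junk law is the same for
`μ` and `-μ`, so the coupling is immediate (`lt_of_isPolyMarginBound`). With `±e`, for every `κ <
1`, the margin stays above `T/10`, and one of the two signs gives test loss at least `1/2`. Here the
coupling uses a Haar random rotation: the reflection exchanging `e` and `μ` fixes the junk, so after
averaging over rotations, signal `e` and signal `μ` yield the same sample law
(`lt_of_isPolyMarginBound'`).

Usefulness `3/4` minus `1/8` leaves probability `5/8`, against at most `1/4`, respectively `1/4 +
1/4`, allowed by the bound. Hence `G` dominates the claimed maximum to the power `p` times `T ^ p`,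
and the maximum margin is at most `T` on the good samples. -/

/-! ### The normalized surface measure: isometry invariance and spherical caps. -/

section SphereLaw

open Set Metric Pointwise Measure

variable {F F' : Type*} [NormedAddCommGroup F] [InnerProductSpace ℝ F]
  [NormedAddCommGroup F'] [InnerProductSpace ℝ F']

/-- The map induced on unit spheres by a linear isometry. -/
def sphereMap (V : F ≃ₗᵢ[ℝ] F') (x : sphere (0 : F) 1) : sphere (0 : F') 1 :=
  ⟨V x, by simp⟩

lemma continuous_sphereMap (V : F ≃ₗᵢ[ℝ] F') : Continuous (sphereMap V) :=
  Continuous.subtype_mk (V.continuous.comp continuous_subtype_val) _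

variable [MeasurableSpace F] [BorelSpace F] [MeasurableSpace F'] [BorelSpace F']

lemma smul_toSphere (c : ENNReal) (ν : Measure F) : (c • ν).toSphere = c • ν.toSphere := by
  ext s hs
  simp only [toSphere_apply' _ hs, Measure.smul_apply, smul_eq_mul]
  ring

lemma map_sphereMap_toSphere (V : F ≃ₗᵢ[ℝ] F') (ν : Measure F) :
    ν.toSphere.map (sphereMap V) = (ν.map V).toSphere := by
  ext s hs
  rw [Measure.map_apply (continuous_sphereMap V).measurable hs,
    toSphere_apply' _ ((continuous_sphereMap V).measurable hs), toSphere_apply' _ hs,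
    V.toHomeomorph.toMeasurableEquiv.map_apply (μ := ν) _ |> fun h => (h : ν.map V _ = _),
    V.toLinearEquiv.finrank_eq]
  congr 2
  ext x
  simp only [Set.mem_smul, mem_image, Set.mem_preimage]
  constructor
  · rintro ⟨r, hr, _, ⟨y, hy, rfl⟩, rfl⟩
    exact ⟨r, hr, _, ⟨sphereMap V y, hy, rfl⟩, by simp [sphereMap]⟩
  · rintro ⟨r, hr, _, ⟨y, hy, rfl⟩, h⟩
    refine ⟨r, hr, _, ⟨sphereMap V.symm y, ?_, rfl⟩, ?_⟩
    · convert hy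
      ext
      simp [sphereMap]
    · apply V.injective
      simpa [sphereMap] using h

variable [FiniteDimensional ℝ F] [FiniteDimensional ℝ F']

/-- The surface measure of the unit sphere, normalized to total mass one. -/
noncomputable def sphereProb (F : Type*) [NormedAddCommGroup F] [InnerProductSpace ℝ F]
    [FiniteDimensional ℝ F] [MeasurableSpace F] [BorelSpace F] : Measure (sphere (0 : F) 1) :=
  ((addHaar : Measure F).toSphere univ)⁻¹ • (addHaar : Measure F).toSphere

/-- An isometry carries one additive Haar measure to a positive finite multiple `c` of the other,
and the normalization to total mass one cancels `c`. -/
lemma map_sphereMap_sphereProb (V : F ≃ₗᵢ[ℝ] F') :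
    (sphereProb F).map (sphereMap V) = sphereProb F' := by
  have h1 : ((addHaar : Measure F).map V).IsAddHaarMeasure :=
    V.toContinuousLinearEquiv.isAddHaarMeasure_map (addHaar : Measure F)
  have h2 := isAddLeftInvariant_eq_smul ((addHaar : Measure F).map V) (addHaar : Measure F')
  obtain ⟨c, hc0, hct, hc⟩ : ∃ c : ENNReal, c ≠ 0 ∧ c ≠ ⊤ ∧
      (addHaar : Measure F).map V = c • (addHaar : Measure F') := by
    refine ⟨_, ?_, ?_, h2⟩
    · simpa using (addHaarScalarFactor_pos_of_isAddHaarMeasure ((addHaar : Measure F).map V)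
        (addHaar : Measure F')).ne'
    · simp
  have hu : (addHaar : Measure F).toSphere univ = c * (addHaar : Measure F').toSphere univ := by
    have := congrArg (fun m => m univ) (map_sphereMap_toSphere V (addHaar : Measure F))
    simp only [hc, smul_toSphere] at this
    rw [Measure.map_apply (continuous_sphereMap V).measurable .univ] at this
    simpa using this
  rw [sphereProb, sphereProb, Measure.map_smul, map_sphereMap_toSphere, hc, smul_toSphere,
    hu, smul_smul]
  congr 1
  rw [ENNReal.mul_inv (Or.inl hc0) (Or.inl hct), mul_comm, ← mul_assoc, ENNReal.mul_inv_cancel hc0 hct,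
    one_mul]

lemma isProbabilityMeasure_sphereProb (h : 0 < Module.finrank ℝ F) :
    IsProbabilityMeasure (sphereProb F) := by
  constructor
  have : Nontrivial F := Module.finrank_pos_iff.1 h
  rw [sphereProb, Measure.smul_apply, smul_eq_mul]
  refine ENNReal.inv_mul_cancel ?_ (measure_ne_top _ _)
  rw [Ne, measure_univ_eq_zero]
  exact (addHaar : Measure F).toSphere_ne_zero

/-- Exponential bound for the measure of a spherical cap. -/
lemma sphereProb_cap_le (hF : 0 < Module.finrank ℝ F) (u : F) (hu : ‖u‖ = 1) (t : ℝ) (ht : 0 ≤ t)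
    (ht2 : t ^ 2 ≤ 1 / 2) :
    sphereProb F {x | t ≤ inner ℝ u (x : F)} ≤
      ENNReal.ofReal (Real.exp (-(Module.finrank ℝ F * t ^ 2 / 2))) := by
  have : Nontrivial F := Module.finrank_pos_iff.1 hF
  set D := Module.finrank ℝ F with hD
  set ν := (addHaar : Measure F)
  have hm : MeasurableSet {x : sphere (0 : F) 1 | t ≤ inner ℝ u (x : F)} :=
    measurableSet_le measurable_const (by fun_prop)
  have hs : 0 ≤ 1 - t ^ 2 := by linarith
  -- The surface measure of the cap is the dimension times the volume of the cone over it. That cone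
  -- fits in a ball of radius `√(1 - t²)`: expanding the square reduces this to `2t² ≤ 1 + r` for
  -- every `r` in `(0, 1)`, which is what `t² ≤ 1/2` provides.
  have hsub : Ioo (0 : ℝ) 1 • (((↑) : sphere (0 : F) 1 → F) '' {x | t ≤ inner ℝ u (x : F)}) ⊆
      closedBall (t • u) (√(1 - t ^ 2)) := by
    intro z hz
    obtain ⟨r, hr, _, ⟨y, hy, rfl⟩, rfl⟩ := Set.mem_smul.1 hz
    have hy1 : ‖(y : F)‖ = 1 := by simp
    have hy' : t ≤ inner ℝ u (y : F) := hy
    rw [mem_closedBall, dist_eq_norm]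
    apply Real.le_sqrt_of_sq_le
    rw [norm_sub_sq_real, norm_smul, norm_smul, hu, hy1, inner_smul_left, inner_smul_right,
      real_inner_comm]
    simp only [Real.norm_eq_abs, mul_one, sq_abs, conj_trivial]
    have h1 : r * (t * t) ≤ r * (t * inner ℝ u (y : F)) :=
      mul_le_mul_of_nonneg_left (mul_le_mul_of_nonneg_left hy' ht) hr.1.le
    nlinarith [hr.1, hr.2, mul_nonneg (sub_nonneg.2 hr.2.le) hr.1.le]
  rw [sphereProb, Measure.smul_apply, smul_eq_mul, toSphere_apply_univ, toSphere_apply' _ hm]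
  have hb0 : ν (ball 0 1) ≠ 0 := (measure_ball_pos _ _ one_pos).ne'
  have hbt : ν (ball 0 1) ≠ ⊤ := measure_ball_lt_top.ne
  have hle : ν (Ioo (0 : ℝ) 1 • (((↑) : sphere (0 : F) 1 → F) '' {x | t ≤ inner ℝ u (x : F)})) ≤
      ENNReal.ofReal (√(1 - t ^ 2) ^ D) * ν (ball 0 1) :=
    (measure_mono hsub).trans (addHaar_closedBall _ _ (Real.sqrt_nonneg _)).le
  have hexp : √(1 - t ^ 2) ^ D ≤ Real.exp (-(D * t ^ 2 / 2)) := by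
    have h1 : √(1 - t ^ 2) ≤ Real.exp (-(t ^ 2 / 2)) := by
      rw [Real.sqrt_le_left (Real.exp_pos _).le, ← Real.exp_nat_mul]
      have := Real.add_one_le_exp (-t ^ 2)
      have h3 : ((2 : ℕ) : ℝ) * -(t ^ 2 / 2) = - t ^ 2 := by push_cast; ring
      rw [h3]; linarith
    calc √(1 - t ^ 2) ^ D ≤ Real.exp (-(t ^ 2 / 2)) ^ D :=
          pow_le_pow_left₀ (Real.sqrt_nonneg _) h1 _
      _ = Real.exp (-(D * t ^ 2 / 2)) := by rw [← Real.exp_nat_mul]; congr 1; ring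
  have hD0 : (D : ENNReal) ≠ 0 := by simpa using hF.ne'
  have hDt : (D : ENNReal) ≠ ⊤ := by simp
  calc _ ≤ ((D : ENNReal) * ν (ball 0 1))⁻¹ * (D * (ENNReal.ofReal (√(1 - t ^ 2) ^ D) * ν (ball 0 1))) := by
        gcongr
    _ = (((D : ENNReal) * ν (ball 0 1))⁻¹ * (D * ν (ball 0 1))) * ENNReal.ofReal (√(1 - t ^ 2) ^ D) := by
        ring
    _ = ENNReal.ofReal (√(1 - t ^ 2) ^ D) := by
        rw [ENNReal.inv_mul_cancel (mul_ne_zero hD0 hb0) (ENNReal.mul_ne_top hDt hbt), one_mul]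
    _ ≤ _ := ENNReal.ofReal_le_ofReal hexp

end SphereLaw

/-! ### The junk law: support, rotation equivariance and tails. -/

section JunkLaw

variable {d : ℕ}

lemma finrank_orthogonal_span (μ : Feat d) (hμ : ‖μ‖ = 1) :
    Module.finrank ℝ (Submodule.span ℝ {μ})ᗮ = d - 1 := by
  have h := (Submodule.span ℝ {μ}).finrank_add_finrank_orthogonal
  rw [finrank_span_singleton (by rintro rfl; simp at hμ), finrank_euclideanSpace_fin] at h
  omega

lemma isProbabilityMeasure_junkLaw (μ : Feat d) (hμ : ‖μ‖ = 1) (hd : 2 ≤ d) (σ : ℝ) :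
    IsProbabilityMeasure (junkLaw μ σ) := by
  have : IsProbabilityMeasure (unitSphereLaw μ) :=
    isProbabilityMeasure_sphereProb (by rw [finrank_orthogonal_span μ hμ]; omega)
  exact Measure.isProbabilityMeasure_map (by fun_prop)

/-- `U` restricts to an isometry from the hyperplane orthogonal to `μ` onto the one orthogonal to `U
μ`, and such isometries preserve normalized surface measure. -/
lemma map_junkLaw (U : Feat d ≃ₗᵢ[ℝ] Feat d) (μ : Feat d) (σ : ℝ) :
    (junkLaw μ σ).map U = junkLaw (U μ) σ := by
  have hF : (Submodule.span ℝ {μ})ᗮ.map (U.toLinearEquiv : Feat d →ₗ[ℝ] Feat d) =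
      (Submodule.span ℝ {U μ})ᗮ := by
    rw [Submodule.map_orthogonal_equiv, Submodule.map_span, Set.image_singleton]
    rfl
  let V : (Submodule.span ℝ {μ})ᗮ ≃ₗᵢ[ℝ] (Submodule.span ℝ {U μ})ᗮ :=
    (U.submoduleMap _).trans (LinearIsometryEquiv.ofEq _ _ hF)
  have hV : ∀ x, (V x : Feat d) = U x := fun x => rfl
  have := map_sphereMap_sphereProb V
  rw [junkLaw, junkLaw]
  change _ = (sphereProb _).map _
  rw [← this, Measure.map_map (by fun_prop) (by fun_prop),
    Measure.map_map (by fun_prop) (continuous_sphereMap V).measurable]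
  congr 1
  ext1 x
  simp [sphereMap, hV]

lemma ae_junkLaw (μ : Feat d) (σ : ℝ) :
    ∀ᵐ ξ ∂junkLaw μ σ, inner ℝ μ ξ = 0 ∧ ‖ξ‖ = √((d : ℝ) - 1) * |σ| := by
  rw [junkLaw, ae_map_iff (by fun_prop)]
  · refine Filter.Eventually.of_forall fun x => ⟨?_, ?_⟩
    · rw [inner_smul_right, Submodule.mem_orthogonal_singleton_iff_inner_right.1 x.1.2, mul_zero]
    · have hx : ‖((x : (Submodule.span ℝ {μ})ᗮ) : Feat d)‖ = 1 := by
        have := norm_eq_of_mem_sphere x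
        rwa [Submodule.norm_coe]
      rw [norm_smul, hx, Real.norm_eq_abs, abs_mul, abs_of_nonneg (Real.sqrt_nonneg _), mul_one]
  · exact (measurableSet_eq_fun (by fun_prop) (by fun_prop)).inter
      (measurableSet_eq_fun (by fun_prop) (by fun_prop))

/-- Exponential tail bound for a linear functional of the junk component. -/
lemma junkLaw_tail (μ : Feat d) (hμ : ‖μ‖ = 1) (hd : 2 ≤ d) {σ : ℝ} (hσ : 0 < σ) (w : Feat d)
    (hw : ‖w‖ ≤ 1) {a : ℝ} (ha : 0 < a) (h2 : a ^ 2 ≤ ((d : ℝ) - 1) * σ ^ 2 / 2) :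
    junkLaw μ σ {ξ | a < inner ℝ w ξ} ≤ ENNReal.ofReal (Real.exp (-(a ^ 2 / (2 * σ ^ 2)))) := by
  have hd' : (0 : ℝ) < (d : ℝ) - 1 := by
    have : (2 : ℝ) ≤ d := by exact_mod_cast hd
    linarith
  set R := √((d : ℝ) - 1) * σ with hR
  have hR0 : 0 < R := mul_pos (Real.sqrt_pos.2 hd') hσ
  have hR2 : R ^ 2 = ((d : ℝ) - 1) * σ ^ 2 := by
    rw [hR, mul_pow, Real.sq_sqrt hd'.le]
  rw [junkLaw, Measure.map_apply (by fun_prop) (measurableSet_lt (by fun_prop) (by fun_prop))]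
  -- Only the component of `w` in the hyperplane acts on the junk; normalizing it, which can only
  -- enlarge the inner product, turns the event into a cap of height `a / R`.
  set w' : (Submodule.span ℝ {μ})ᗮ := (Submodule.span ℝ {μ})ᗮ.orthogonalProjectionOnto w
  have hw' : ‖w'‖ ≤ 1 := (Submodule.norm_orthogonalProjectionOnto_apply_le _ _).trans hw
  have hin : ∀ x : (Submodule.span ℝ {μ})ᗮ, inner ℝ w (x : Feat d) = inner ℝ w' x := by
    intro x
    rw [real_inner_comm, real_inner_comm x w']
    exact (Submodule.inner_orthogonalProjectionOnto_eq_of_mem_left x w).symm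
  by_cases h0 : w' = 0
  · have : (fun u : Metric.sphere (0 : (Submodule.span ℝ {μ})ᗮ) 1 => R • ((u : (Submodule.span ℝ {μ})ᗮ) : Feat d)) ⁻¹' {ξ | a < inner ℝ w ξ} = ∅ := by
      ext x
      simp only [Set.mem_preimage, Set.mem_ofPred_eq, inner_smul_right, hin, h0, inner_zero_left,
        mul_zero, Set.mem_empty_iff_false, iff_false, not_lt]
      exact ha.le
    rw [this]
    simp
  have hn : 0 < ‖w'‖ := norm_pos_iff.2 h0
  have hcap := sphereProb_cap_le (F := (Submodule.span ℝ {μ})ᗮ)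
    (by rw [finrank_orthogonal_span μ hμ]; omega) (‖w'‖⁻¹ • w')
    (by rw [norm_smul, norm_inv, norm_norm, inv_mul_cancel₀ hn.ne']) (a / R) (by positivity)
    (by rw [div_pow, hR2, div_le_iff₀ (by positivity)]; linarith)
  refine (measure_mono ?_).trans (hcap.trans (ENNReal.ofReal_le_ofReal (Real.exp_le_exp.2 ?_)))
  · intro x hx
    simp only [Set.mem_preimage, Set.mem_ofPred_eq, inner_smul_right, hin] at hx
    simp only [Set.mem_ofPred_eq, inner_smul_left, conj_trivial]
    have h3 : a / R < inner ℝ w' (x : (Submodule.span ℝ {μ})ᗮ) := by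
      rw [div_lt_iff₀ hR0, mul_comm]; exact hx
    have h4 : 0 < a / R := by positivity
    have h5 : 1 ≤ ‖w'‖⁻¹ := (one_le_inv₀ hn).2 hw'
    nlinarith
  · rw [finrank_orthogonal_span μ hμ, Nat.cast_sub (by omega), Nat.cast_one, div_pow, hR2]
    apply le_of_eq
    field_simp

end JunkLaw

/-! ### Second and fourth moments of projections of the junk. -/

section Moments

variable {d : ℕ}

lemma integrable_junkLaw (μ : Feat d) (σ : ℝ) (f : Feat d → ℝ) (hf : Continuous f) :
    Integrable f (junkLaw μ σ) := by
  have : IsFiniteMeasure (unitSphereLaw μ) := by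
    by_cases h : (Measure.addHaar : Measure (Submodule.span ℝ {μ})ᗮ).toSphere = 0
    · rw [unitSphereLaw, h, smul_zero]; infer_instance
    · have : (Measure.addHaar : Measure (Submodule.span ℝ {μ})ᗮ).toSphere Set.univ ≠ 0 := by
        rwa [Ne, Measure.measure_univ_eq_zero]
      exact Measure.smul_finite _ (ENNReal.inv_ne_top.2 this)
  rw [junkLaw, integrable_map_measure hf.aestronglyMeasurable (by fun_prop)]
  exact Continuous.integrable_of_hasCompactSupport (by fun_prop) (HasCompactSupport.of_compactSpace _)

lemma integral_junkLaw_comp (U : Feat d ≃ₗᵢ[ℝ] Feat d) (μ : Feat d) (hU : U μ = μ) (σ : ℝ)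
    (f : Feat d → ℝ) (hf : Continuous f) :
    ∫ ξ, f (U ξ) ∂junkLaw μ σ = ∫ ξ, f ξ ∂junkLaw μ σ := by
  conv_rhs => rw [← hU, ← map_junkLaw U]
  rw [integral_map (by fun_prop) hf.aestronglyMeasurable]

/-- The reflection exchanging `u` and `v` fixes `μ`, hence preserves the junk law. -/
lemma integral_inner_pow_eq (μ : Feat d) (σ : ℝ) (p : ℕ) (u v : Feat d) (hu : inner ℝ μ u = 0)
    (hv : inner ℝ μ v = 0) (h : ‖u‖ = ‖v‖) :
    ∫ ξ, (inner ℝ u ξ) ^ p ∂junkLaw μ σ = ∫ ξ, (inner ℝ v ξ) ^ p ∂junkLaw μ σ := by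
  set U := (Submodule.span ℝ {u - v})ᗮ.reflection with hU
  have hμ : U μ = μ := by
    apply Submodule.reflection_mem_subspace_eq_self
    rw [Submodule.mem_orthogonal_singleton_iff_inner_left, inner_sub_right, hu, hv, sub_zero]
  have huv : U u = v := Submodule.reflection_sub h
  rw [← integral_junkLaw_comp U μ hμ σ (fun ξ => (inner ℝ v ξ) ^ p) (by fun_prop)]
  congr 1
  ext ξ
  rw [← huv, U.inner_map_map]

lemma norm_sq_starProjection_eq_sum {E : Type*} [NormedAddCommGroup E] [InnerProductSpace ℝ E]
    (K : Submodule ℝ E) [FiniteDimensional ℝ K] (x : E) :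
    ‖K.starProjection x‖ ^ 2 =
      ∑ i, (inner ℝ ((stdOrthonormalBasis ℝ K i : K) : E) x) ^ 2 := by
  have h := (stdOrthonormalBasis ℝ K).sum_sq_norm_inner_right (K.orthogonalProjectionOnto x)
  rw [Submodule.starProjection_apply, Submodule.norm_coe, ← h]
  refine Finset.sum_congr rfl fun i _ => ?_
  rw [Submodule.inner_orthogonalProjectionOnto_eq_of_mem_left, Real.norm_eq_abs, sq_abs]

/-- By symmetry the moments depend on a subspace of `μ^⊥` only through its dimension. The constants
are left unknown here; they are identified afterwards on the full hyperplane, where the norm is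
constant. -/
lemma exists_moments (μ : Feat d) (σ : ℝ) :
    ∃ m2 m4 : ℝ, ∀ K : Submodule ℝ (Feat d), (∀ x ∈ K, inner ℝ μ x = 0) →
      ∫ ξ, ‖K.starProjection ξ‖ ^ 2 ∂junkLaw μ σ = Module.finrank ℝ K * m2 ∧
      ∫ ξ, ‖K.starProjection ξ‖ ^ 4 ∂junkLaw μ σ =
        Module.finrank ℝ K * (Module.finrank ℝ K + 2) * m4 := by
  by_cases hex : ∃ u0 : Feat d, inner ℝ μ u0 = 0 ∧ ‖u0‖ = 1
  swap
  · refine ⟨0, 0, fun K hK => ?_⟩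
    have : K = ⊥ := by
      rw [Submodule.eq_bot_iff]
      intro x hx
      by_contra h0
      refine hex ⟨‖x‖⁻¹ • x, by rw [inner_smul_right, hK x hx, mul_zero], ?_⟩
      rw [norm_smul, norm_inv, norm_norm, inv_mul_cancel₀ (norm_ne_zero_iff.2 h0)]
    subst this
    simp
  obtain ⟨u0, hu0, hu1⟩ := hex
  set m2 := ∫ ξ, (inner ℝ u0 ξ) ^ 2 ∂junkLaw μ σ with hm2
  set m4 := ∫ ξ, (inner ℝ u0 ξ) ^ 4 ∂junkLaw μ σ with hm4
  have hp2 : ∀ u : Feat d, inner ℝ μ u = 0 → ‖u‖ = 1 →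
      ∫ ξ, (inner ℝ u ξ) ^ 2 ∂junkLaw μ σ = m2 := fun u h h' =>
    integral_inner_pow_eq μ σ 2 u u0 h hu0 (h'.trans hu1.symm)
  have hp4 : ∀ u : Feat d, inner ℝ μ u = 0 → ‖u‖ = 1 →
      ∫ ξ, (inner ℝ u ξ) ^ 4 ∂junkLaw μ σ = m4 := fun u h h' =>
    integral_inner_pow_eq μ σ 4 u u0 h hu0 (h'.trans hu1.symm)
  have hp22 : ∀ u v : Feat d, inner ℝ μ u = 0 → ‖u‖ = 1 → inner ℝ μ v = 0 → ‖v‖ = 1 →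
      inner ℝ u v = 0 →
      ∫ ξ, (inner ℝ u ξ) ^ 2 * (inner ℝ v ξ) ^ 2 ∂junkLaw μ σ = m4 / 3 := by
    intro u v hu hu1 hv hv1 huv
    -- Polarization: `(u ± v)/√2` are unit vectors, so they have fourth moment `m4` as well. Adding
    -- the two expansions isolates the mixed moment.
    have hs : ∀ s : ℝ, s ^ 2 = 1 →
        ∫ ξ, (inner ℝ u ξ + s * inner ℝ v ξ) ^ 4 ∂junkLaw μ σ = 4 * m4 := by
      intro s hs
      have hn : ‖u + s • v‖ = √2 := by
        rw [← Real.sqrt_sq (norm_nonneg (u + s • v)), norm_add_sq_real, inner_smul_right, huv,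
          norm_smul, hu1, hv1, mul_one, Real.norm_eq_abs, sq_abs, hs]
        norm_num
      have h1 := hp4 ((√2)⁻¹ • (u + s • v))
        (by rw [inner_smul_right, inner_add_right, inner_smul_right, hu, hv]; simp)
        (by rw [norm_smul, hn, norm_inv, Real.norm_of_nonneg (Real.sqrt_nonneg _)]
            exact inv_mul_cancel₀ (by positivity))
      have h4 : (√2)⁻¹ ^ 4 = (1 / 4 : ℝ) := by
        rw [inv_pow, show (4 : ℕ) = 2 * 2 from rfl, pow_mul, Real.sq_sqrt (by norm_num)]
        norm_num
      have h5 : ∀ ξ : Feat d, (inner ℝ ((√2)⁻¹ • (u + s • v)) ξ) ^ 4 =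
          (1 / 4) * (inner ℝ u ξ + s * inner ℝ v ξ) ^ 4 := by
        intro ξ
        rw [inner_smul_left, inner_add_left, inner_smul_left, mul_pow]
        simp only [conj_trivial]
        rw [h4]
      rw [integral_congr_ae (Filter.Eventually.of_forall h5), integral_const_mul] at h1
      linarith
    have ha := hs 1 (by norm_num)
    have hb := hs (-1) (by norm_num)
    have hsum : ∫ ξ, (inner ℝ u ξ + 1 * inner ℝ v ξ) ^ 4 ∂junkLaw μ σ +
        ∫ ξ, (inner ℝ u ξ + (-1) * inner ℝ v ξ) ^ 4 ∂junkLaw μ σ =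
        (∫ ξ, 2 * (inner ℝ u ξ) ^ 4 ∂junkLaw μ σ + ∫ ξ, 2 * (inner ℝ v ξ) ^ 4 ∂junkLaw μ σ) +
          ∫ ξ, 12 * ((inner ℝ u ξ) ^ 2 * (inner ℝ v ξ) ^ 2) ∂junkLaw μ σ := by
      rw [← integral_add, ← integral_add, ← integral_add]
      · congr 1
        ext ξ
        ring
      all_goals exact integrable_junkLaw μ σ _ (by fun_prop)
    rw [ha, hb, integral_const_mul, integral_const_mul, integral_const_mul, hp4 u hu hu1,
      hp4 v hv hv1] at hsum
    linarith
  refine ⟨m2, m4 / 3, fun K hK => ?_⟩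
  set b := stdOrthonormalBasis ℝ K with hb
  have hbn : ∀ i, ‖((b i : K) : Feat d)‖ = 1 := fun i => by
    rw [Submodule.norm_coe]; exact b.orthonormal.1 i
  have hbμ : ∀ i, inner ℝ μ ((b i : K) : Feat d) = 0 := fun i => hK _ (b i).2
  have hbo : ∀ i j, i ≠ j → inner ℝ ((b i : K) : Feat d) ((b j : K) : Feat d) = 0 :=
    fun i j hij => by rw [← Submodule.coe_inner]; exact b.orthonormal.2 hij
  constructor
  · simp_rw [norm_sq_starProjection_eq_sum]
    rw [integral_finsetSum _ fun i _ => integrable_junkLaw μ σ _ (by fun_prop)]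
    rw [Finset.sum_congr rfl fun i _ => hp2 _ (hbμ i) (hbn i)]
    simp
  · have h4 : ∀ ξ, ‖K.starProjection ξ‖ ^ 4 = ∑ i, ∑ j,
        (inner ℝ ((b i : K) : Feat d) ξ) ^ 2 * (inner ℝ ((b j : K) : Feat d) ξ) ^ 2 := by
      intro ξ
      rw [show (4 : ℕ) = 2 * 2 from rfl, pow_mul, norm_sq_starProjection_eq_sum, sq,
        Finset.sum_mul_sum]
    simp_rw [h4]
    rw [integral_finsetSum _ fun i _ => integrable_junkLaw μ σ _ (by fun_prop),
      Finset.sum_congr rfl fun i _ => integral_finsetSum _ fun j _ =>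
        integrable_junkLaw μ σ _ (by fun_prop)]
    have hij : ∀ i j, ∫ ξ, (inner ℝ ((b i : K) : Feat d) ξ) ^ 2 *
        (inner ℝ ((b j : K) : Feat d) ξ) ^ 2 ∂junkLaw μ σ =
        m4 / 3 + if i = j then 2 * (m4 / 3) else 0 := by
      intro i j
      split_ifs with h
      · subst h
        have : ∀ ξ : Feat d, (inner ℝ ((b i : K) : Feat d) ξ) ^ 2 *
          (inner ℝ ((b i : K) : Feat d) ξ) ^ 2 = (inner ℝ ((b i : K) : Feat d) ξ) ^ 4 :=
          fun ξ => by ring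
        simp_rw [this]
        rw [hp4 _ (hbμ i) (hbn i)]; ring
      · rw [hp22 _ _ (hbμ i) (hbn i) (hbμ j) (hbn j) (hbo i j h), add_zero]
    simp_rw [hij, Finset.sum_add_distrib]
    simp
    ring

/-- Second and fourth moments of the projection of the junk component to a subspace of `μ^⊥`. -/
lemma integral_norm_starProjection (μ : Feat d) (hμ : ‖μ‖ = 1) (hd : 2 ≤ d) (σ : ℝ)
    (K : Submodule ℝ (Feat d)) (hK : ∀ x ∈ K, inner ℝ μ x = 0) :
    ∫ ξ, ‖K.starProjection ξ‖ ^ 2 ∂junkLaw μ σ = Module.finrank ℝ K * σ ^ 2 ∧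
      ∫ ξ, ‖K.starProjection ξ‖ ^ 4 ∂junkLaw μ σ =
        Module.finrank ℝ K * (Module.finrank ℝ K + 2) * (σ ^ 4 * (((d : ℝ) - 1) / (d + 1))) := by
  have hd' : (0 : ℝ) < (d : ℝ) - 1 := by
    have : (2 : ℝ) ≤ d := by exact_mod_cast hd
    linarith
  have := isProbabilityMeasure_junkLaw μ hμ hd σ
  obtain ⟨m2, m4, h⟩ := exists_moments μ σ
  have hF := h (Submodule.span ℝ {μ})ᗮ fun x hx =>
    Submodule.mem_orthogonal_singleton_iff_inner_right.1 hx
  -- On the whole hyperplane the projected norm is almost surely the sphere radius, which determines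
  -- `m2` and `m4`.
  have hae : ∀ᵐ ξ ∂junkLaw μ σ, ‖(Submodule.span ℝ {μ})ᗮ.starProjection ξ‖ ^ 2 =
      ((d : ℝ) - 1) * σ ^ 2 := by
    filter_upwards [ae_junkLaw μ σ] with ξ hξ
    rw [Submodule.starProjection_eq_self_iff.2
      (Submodule.mem_orthogonal_singleton_iff_inner_right.2 hξ.1), hξ.2, mul_pow,
      Real.sq_sqrt hd'.le, sq_abs]
  have hfr : (Module.finrank ℝ (Submodule.span ℝ {μ})ᗮ : ℝ) = d - 1 := by
    rw [finrank_orthogonal_span μ hμ, Nat.cast_sub (by omega), Nat.cast_one]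
  have hae4 : ∀ᵐ ξ ∂junkLaw μ σ, ‖(Submodule.span ℝ {μ})ᗮ.starProjection ξ‖ ^ 4 =
      (((d : ℝ) - 1) * σ ^ 2) ^ 2 := by
    filter_upwards [hae] with ξ hξ
    rw [← hξ]; ring
  rw [integral_congr_ae hae, integral_congr_ae hae4] at hF
  simp only [integral_const, probReal_univ, smul_eq_mul, one_mul, hfr] at hF
  have e2 : m2 = σ ^ 2 := by
    have := hF.1
    exact (mul_left_cancel₀ hd'.ne' this).symm
  have e4 : m4 = σ ^ 4 * (((d : ℝ) - 1) / (d + 1)) := by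
    have h1 := hF.2
    have h2 : ((d : ℝ) - 1) * (((d : ℝ) - 1) * σ ^ 4) = (d - 1) * ((d + 1) * m4) := by
      rw [show ((d : ℝ) - 1) * ((d + 1) * m4) = (d - 1) * (d - 1 + 2) * m4 by ring, ← h1]; ring
    have h3 := mul_left_cancel₀ hd'.ne' h2
    field_simp
    linarith
  rw [← e2, ← e4]
  exact h K hK

lemma integral_inner_sq (μ : Feat d) (hμ : ‖μ‖ = 1) (hd : 2 ≤ d) (σ : ℝ) (v : Feat d)
    (hv : inner ℝ μ v = 0) :
    ∫ ξ, (inner ℝ v ξ) ^ 2 ∂junkLaw μ σ = ‖v‖ ^ 2 * σ ^ 2 := by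
  by_cases h0 : v = 0
  · simp [h0]
  have h := (integral_norm_starProjection μ hμ hd σ (Submodule.span ℝ {v}) (fun x hx => by
    obtain ⟨a, rfl⟩ := Submodule.mem_span_singleton.1 hx
    rw [inner_smul_right, hv, mul_zero])).1
  rw [finrank_span_singleton h0] at h
  have hn : ‖v‖ ≠ 0 := norm_ne_zero_iff.2 h0
  have h1 : ∀ ξ : Feat d, (inner ℝ v ξ) ^ 2 =
      ‖v‖ ^ 2 * ‖(Submodule.span ℝ {v}).starProjection ξ‖ ^ 2 := by
    intro ξ
    rw [Submodule.starProjection_singleton, norm_smul, mul_pow, Real.norm_eq_abs, sq_abs]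
    simp only [RCLike.ofReal_real_eq_id, id_eq]
    field_simp
  simp_rw [h1]
  rw [integral_const_mul, h]
  simp

/-- The projection of the junk component to a low-dimensional subspace is rarely long. -/
lemma junkLaw_half_lt_starProjection (μ : Feat d) (hμ : ‖μ‖ = 1) (hd : 2 ≤ d) {σ : ℝ} (hσ : 0 < σ)
    (K : Submodule ℝ (Feat d)) (hK : ∀ x ∈ K, inner ℝ μ x = 0) (k : ℝ)
    (hk : (Module.finrank ℝ K : ℝ) ≤ k) (hkd : 4 * k ≤ (d : ℝ) - 1) :
    junkLaw μ σ {ξ | ((d : ℝ) - 1) * σ ^ 2 / 2 < ‖K.starProjection ξ‖ ^ 2} ≤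
      ENNReal.ofReal (32 * k / ((d : ℝ) - 1) ^ 2) := by
  have hd' : (0 : ℝ) < (d : ℝ) - 1 := by
    have : (2 : ℝ) ≤ d := by exact_mod_cast hd
    linarith
  have := isProbabilityMeasure_junkLaw μ hμ hd σ
  obtain ⟨h2, h4⟩ := integral_norm_starProjection μ hμ hd σ K hK
  set D := (d : ℝ) - 1 with hD
  set q := (Module.finrank ℝ K : ℝ) with hq
  have hq0 : 0 ≤ q := Nat.cast_nonneg _
  -- The variance is at most `(q(q + 2) - q²) σ⁴ = 2qσ⁴`. Since the mean is at most a quarter of the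
  -- squared radius, exceeding half of it is a deviation by a further quarter, and Chebyshev
  -- applies.
  have hint : ∫ ξ, (‖K.starProjection ξ‖ ^ 2 - q * σ ^ 2) ^ 2 ∂junkLaw μ σ ≤ 2 * k * σ ^ 4 := by
    have he : ∀ ξ, (‖K.starProjection ξ‖ ^ 2 - q * σ ^ 2) ^ 2 =
        (‖K.starProjection ξ‖ ^ 4 - (2 * q * σ ^ 2) * ‖K.starProjection ξ‖ ^ 2) + q ^ 2 * σ ^ 4 :=
      fun ξ => by ring
    simp_rw [he]
    rw [integral_add, integral_sub, integral_const_mul, h2, h4]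
    · simp only [integral_const, probReal_univ, smul_eq_mul, one_mul]
      have h5 : D / ((d : ℝ) + 1) ≤ 1 := by
        rw [div_le_one (by linarith)]; linarith
      have h6 : 0 ≤ q * (q + 2) * σ ^ 4 := by positivity
      have h7 : q * (q + 2) * (σ ^ 4 * (D / (d + 1))) ≤ q * (q + 2) * σ ^ 4 := by
        calc q * (q + 2) * (σ ^ 4 * (D / (d + 1))) = q * (q + 2) * σ ^ 4 * (D / (d + 1)) := by ring
          _ ≤ _ := mul_le_of_le_one_right h6 h5
      have h8 : 2 * q * σ ^ 4 ≤ 2 * k * σ ^ 4 := by gcongr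
      nlinarith
    all_goals
      first
      | exact integrable_const _
      | exact integrable_junkLaw μ σ _ (by fun_prop)
  have hm := mul_meas_ge_le_integral_of_nonneg (μ := junkLaw μ σ)
    (f := fun ξ => (‖K.starProjection ξ‖ ^ 2 - q * σ ^ 2) ^ 2)
    (Filter.Eventually.of_forall fun ξ => sq_nonneg _) (integrable_junkLaw μ σ _ (by fun_prop))
    ((D * σ ^ 2 / 4) ^ 2)
  have hle : junkLaw μ σ {ξ | D * σ ^ 2 / 2 < ‖K.starProjection ξ‖ ^ 2} ≤
      junkLaw μ σ {ξ | (D * σ ^ 2 / 4) ^ 2 ≤ (‖K.starProjection ξ‖ ^ 2 - q * σ ^ 2) ^ 2} := by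
    apply measure_mono
    intro ξ hξ
    simp only [Set.mem_ofPred_eq] at hξ ⊢
    apply pow_le_pow_left₀ (by positivity)
    have : q * σ ^ 2 ≤ (D / 4) * σ ^ 2 := by
      have : q ≤ D / 4 := by linarith
      gcongr
    linarith
  refine hle.trans ?_
  rw [← ofReal_measureReal]
  apply ENNReal.ofReal_le_ofReal
  have h9 : 0 < (D * σ ^ 2 / 4) ^ 2 := by positivity
  rw [← mul_le_mul_iff_right₀ h9]
  refine (hm.trans hint).trans (le_of_eq ?_)
  field_simp
  ring

end Moments

/-! ### Uniform labels and signed sums of fixed vectors. -/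

section Rademacher

/-- As `ℤˣ` is finite, this makes every function of finitely many labels measurable. -/
instance : MeasurableSingletonClass ℤˣ where
  measurableSet_singleton a :=
    ⟨{(a : ℤ)}, MeasurableSet.singleton _, by ext x; simp [Units.val_inj]⟩

instance : IsProbabilityMeasure labelLaw where
  measure_univ := by simp [labelLaw, ENNReal.inv_two_add_inv_two]

lemma labelVal_mul_self (y : ℤˣ) : labelVal y * labelVal y = 1 := by
  rcases Int.units_eq_one_or y with rfl | rfl <;> simp [labelVal]

lemma labelVal_neg (y : ℤˣ) : labelVal (-y) = -labelVal y := by simp [labelVal]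

lemma map_neg_labelLaw : labelLaw.map (fun y => -y) = labelLaw := by
  have hm : Measurable fun y : ℤˣ => -y := measurable_of_finite _
  simp only [labelLaw]
  rw [Measure.map_add _ _ hm, Measure.map_smul, Measure.map_smul,
    Measure.map_dirac' hm, Measure.map_dirac' hm, neg_neg, add_comm]

/-- The law of `n` independent uniform labels. -/
noncomputable def labelsLaw (n : ℕ) : Measure (Fin n → ℤˣ) := Measure.pi fun _ => labelLaw

instance (n : ℕ) : IsProbabilityMeasure (labelsLaw n) := by
  unfold labelsLaw; infer_instance

variable {n : ℕ}

/-- Flipping one label. -/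
def flipLabel (a : Fin n) (y : Fin n → ℤˣ) (i : Fin n) : ℤˣ := if i = a then -y i else y i

lemma integral_flipLabel (a : Fin n) (f : (Fin n → ℤˣ) → ℝ) :
    ∫ y, f (flipLabel a y) ∂labelsLaw n = ∫ y, f y ∂labelsLaw n := by
  have h : MeasurePreserving (flipLabel a) (labelsLaw n) (labelsLaw n) := by
    apply measurePreserving_pi (fun _ : Fin n => labelLaw) (fun _ => labelLaw)
      (f := fun i y => if i = a then -y else y)
    intro i
    refine ⟨measurable_of_finite _, ?_⟩
    by_cases hi : i = a
    · simpa [hi] using map_neg_labelLaw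
    · simp [hi]
  conv_rhs => rw [← h.map_eq]
  rw [integral_map h.measurable.aemeasurable (Integrable.of_finite).aestronglyMeasurable]

/-- The engine of the inductions below: averaging over the sign of the newly added vector removes
all terms odd in that sign. -/
lemma integral_labels_eq_average (a : Fin n) (f : (Fin n → ℤˣ) → ℝ) :
    ∫ y, f y ∂labelsLaw n = ∫ y, (f y + f (flipLabel a y)) / 2 ∂labelsLaw n := by
  rw [integral_div, integral_add .of_finite .of_finite, integral_flipLabel]
  ring

variable {E : Type*} [NormedAddCommGroup E] [InnerProductSpace ℝ E]

/-- A signed sum of vectors. -/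
noncomputable def signedSum (s : Finset (Fin n)) (v : Fin n → E) (y : Fin n → ℤˣ) : E :=
  ∑ i ∈ s, labelVal (y i) • v i

lemma signedSum_insert {a : Fin n} {s : Finset (Fin n)} (ha : a ∉ s) (v : Fin n → E)
    (y : Fin n → ℤˣ) :
    signedSum (insert a s) v y = signedSum s v y + labelVal (y a) • v a := by
  rw [signedSum, Finset.sum_insert ha, add_comm, signedSum]

lemma signedSum_insert_flip {a : Fin n} {s : Finset (Fin n)} (ha : a ∉ s) (v : Fin n → E)
    (y : Fin n → ℤˣ) :
    signedSum (insert a s) v (flipLabel a y) = signedSum s v y - labelVal (y a) • v a := by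
  have h : signedSum s v (flipLabel a y) = signedSum s v y := by
    refine Finset.sum_congr rfl fun i hi => ?_
    rw [flipLabel, if_neg (ne_of_mem_of_not_mem hi ha)]
  rw [signedSum_insert ha, h, flipLabel, if_pos rfl, labelVal_neg, neg_smul, sub_eq_add_neg]

lemma norm_labelVal_smul_sq (y : ℤˣ) (v : E) : ‖labelVal y • v‖ ^ 2 = ‖v‖ ^ 2 := by
  rw [norm_smul, mul_pow, Real.norm_eq_abs, sq_abs, sq, labelVal_mul_self, one_mul]

lemma integral_norm_signedSum_sq (v : Fin n → E) (s : Finset (Fin n)) :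
    ∫ y, ‖signedSum s v y‖ ^ 2 ∂labelsLaw n = ∑ i ∈ s, ‖v i‖ ^ 2 := by
  induction s using Finset.induction_on with
  | empty => simp [signedSum]
  | insert a s ha ih =>
    rw [integral_labels_eq_average a, Finset.sum_insert ha, ← ih]
    have : ∀ y : Fin n → ℤˣ, (‖signedSum (insert a s) v y‖ ^ 2 +
        ‖signedSum (insert a s) v (flipLabel a y)‖ ^ 2) / 2 = ‖v a‖ ^ 2 + ‖signedSum s v y‖ ^ 2 := by
      intro y
      rw [signedSum_insert ha, signedSum_insert_flip ha, norm_add_sq_real, norm_sub_sq_real,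
        norm_labelVal_smul_sq]
      ring
    simp_rw [this]
    rw [integral_add .of_finite .of_finite]
    simp

lemma integral_inner_signedSum_sq (v : Fin n → E) (w : E) (s : Finset (Fin n)) :
    ∫ y, (inner ℝ (signedSum s v y) w) ^ 2 ∂labelsLaw n = ∑ i ∈ s, (inner ℝ (v i) w) ^ 2 := by
  have h := integral_norm_signedSum_sq (fun i => (inner ℝ (v i) w : ℝ)) s
  simp only [Real.norm_eq_abs, sq_abs] at h
  rw [← h]
  congr 1
  ext y
  simp [signedSum, sum_inner, inner_smul_left]

/-- The variance of the squared norm of a Rademacher sum. -/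
lemma integral_norm_signedSum_sq_sub_sq (v : Fin n → E) (s : Finset (Fin n)) :
    ∫ y, (‖signedSum s v y‖ ^ 2 - ∑ i ∈ s, ‖v i‖ ^ 2) ^ 2 ∂labelsLaw n =
      2 * ∑ i ∈ s, ∑ j ∈ s, if i = j then 0 else (inner ℝ (v i) (v j)) ^ 2 := by
  induction s using Finset.induction_on with
  | empty => simp [signedSum]
  | insert a s ha ih =>
    rw [integral_labels_eq_average a]
    -- With `z` the inner product of the old sum with `v a`, the new deviation is the old one plus
    -- or minus `2z`; averaging the squares adds `4z²`.
    have : ∀ y : Fin n → ℤˣ,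
        ((‖signedSum (insert a s) v y‖ ^ 2 - ∑ i ∈ insert a s, ‖v i‖ ^ 2) ^ 2 +
        (‖signedSum (insert a s) v (flipLabel a y)‖ ^ 2 - ∑ i ∈ insert a s, ‖v i‖ ^ 2) ^ 2) / 2 =
        (‖signedSum s v y‖ ^ 2 - ∑ i ∈ s, ‖v i‖ ^ 2) ^ 2 +
          4 * (inner ℝ (signedSum s v y) (v a)) ^ 2 := by
      intro y
      rw [signedSum_insert ha, signedSum_insert_flip ha, norm_add_sq_real, norm_sub_sq_real,
        norm_labelVal_smul_sq, Finset.sum_insert ha, inner_smul_right]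
      have h2 := labelVal_mul_self (y a)
      generalize labelVal (y a) = t at *
      generalize inner ℝ (signedSum s v y) (v a) = z
      linear_combination (4 * z ^ 2) * h2
    simp_rw [this]
    rw [integral_add .of_finite .of_finite, integral_const_mul, ih, integral_inner_signedSum_sq,
      Finset.sum_insert ha, Finset.sum_insert ha]
    have h1 : ∀ i ∈ s, (∑ j ∈ insert a s, if i = j then (0 : ℝ) else (inner ℝ (v i) (v j)) ^ 2) =
        (inner ℝ (v i) (v a)) ^ 2 + ∑ j ∈ s, if i = j then 0 else (inner ℝ (v i) (v j)) ^ 2 := by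
      intro i hi
      rw [Finset.sum_insert ha, if_neg (ne_of_mem_of_not_mem hi ha)]
    have h3 : (∑ j ∈ s, if a = j then (0 : ℝ) else (inner ℝ (v a) (v j)) ^ 2) =
        ∑ j ∈ s, (inner ℝ (v j) (v a)) ^ 2 := by
      refine Finset.sum_congr rfl fun j hj => ?_
      rw [if_neg (ne_of_mem_of_not_mem hj ha).symm, real_inner_comm]
    rw [Finset.sum_congr rfl h1, Finset.sum_add_distrib, h3]
    simp only [if_true]
    ring

end Rademacher

/-! ### Resampling one coordinate of a product measure. -/

section ProductMeasures

/-- Overwriting a coordinate by an independent copy does not change the product law; it suffices to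
compare boxes, where the discarded coordinate contributes a factor one. -/
lemma measurePreserving_update {ι α : Type*} [Fintype ι] [DecidableEq ι] [MeasurableSpace α]
    (ν : ι → Measure α) [∀ i, IsProbabilityMeasure (ν i)] (i : ι) :
    MeasurePreserving (fun p : (ι → α) × α => Function.update p.1 i p.2)
      ((Measure.pi ν).prod (ν i)) (Measure.pi ν) := by
  have hm : Measurable (fun p : (ι → α) × α => Function.update p.1 i p.2) := by
    rw [measurable_pi_iff]
    intro j
    by_cases h : j = i
    · subst h; simpa using measurable_snd
    · simp only [Function.update_of_ne h]
      exact (measurable_pi_apply j).comp measurable_fst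
  refine ⟨hm, ?_⟩
  symm
  apply Measure.pi_eq
  intro s hs
  rw [Measure.map_apply hm (MeasurableSet.univ_pi hs)]
  have : (fun p : (ι → α) × α => Function.update p.1 i p.2) ⁻¹' Set.univ.pi s =
      (Set.univ.pi (Function.update s i Set.univ)) ×ˢ s i := by
    ext p
    simp only [Set.mem_preimage, Set.mem_pi, Set.mem_univ, true_imp_iff, Set.mem_prod]
    constructor
    · intro h
      refine ⟨fun j => ?_, by simpa using h i⟩
      by_cases hj : j = i
      · subst hj; simp
      · simpa [Function.update_of_ne hj] using h j
    · rintro ⟨h1, h2⟩ j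
      by_cases hj : j = i
      · subst hj; simpa using h2
      · simpa [Function.update_of_ne hj] using h1 j
  rw [this, Measure.prod_prod, Measure.pi_pi, ← Finset.mul_prod_erase _ _ (Finset.mem_univ i),
    ← Finset.mul_prod_erase _ (fun j => ν j (s j)) (Finset.mem_univ i)]
  simp only [Function.update_self, measure_univ, one_mul]
  rw [mul_comm]
  congr 1
  refine Finset.prod_congr rfl fun j hj => ?_
  rw [Function.update_of_ne (Finset.ne_of_mem_erase hj)]

/-- An integral over a product of probability spaces can be computed by resampling a coordinate. -/
lemma lintegral_pi_resample {ι α : Type*} [Fintype ι] [DecidableEq ι] [MeasurableSpace α]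
    (ν : ι → Measure α) [∀ i, IsProbabilityMeasure (ν i)] (i : ι) (f : (ι → α) → ENNReal)
    (hf : Measurable f) :
    ∫⁻ x, f x ∂Measure.pi ν = ∫⁻ x, ∫⁻ t, f (Function.update x i t) ∂ν i ∂Measure.pi ν := by
  have h := measurePreserving_update ν i
  conv_lhs => rw [← h.map_eq]
  rw [lintegral_map hf h.measurable]
  exact lintegral_prod _ (hf.comp h.measurable).aemeasurable

end ProductMeasures

/-! ### A sample as a function of independent labels and junk. -/

section SampleLaw

variable {d n : ℕ}

/-- The law of `n` independent junk components. -/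
noncomputable def junksLaw (n : ℕ) (μ : Feat d) (σ : ℝ) : Measure (Fin n → Feat d) :=
  Measure.pi fun _ => junkLaw μ σ

/-- The sample with signal `μ`, labels `y` and junk components `ξ`. -/
noncomputable def mkSample (μ : Feat d) (y : Fin n → ℤˣ) (ξ : Fin n → Feat d) : Sample n d :=
  fun i => (labelVal (y i) • μ + ξ i, y i)

lemma measurable_labelVal : Measurable labelVal := measurable_of_finite _

lemma measurable_mkSample {Ω : Type*} [MeasurableSpace Ω] {m : Ω → Feat d} {y : Ω → Fin n → ℤˣ}
    {ξ : Ω → Fin n → Feat d} (hm : Measurable m) (hy : Measurable y) (hξ : Measurable ξ) :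
    Measurable fun ω => mkSample (m ω) (y ω) (ξ ω) := by
  rw [measurable_pi_iff]
  intro i
  have hy' : Measurable fun ω => y ω i := (measurable_pi_apply i).comp hy
  have hξ' : Measurable fun ω => ξ ω i := (measurable_pi_apply i).comp hξ
  exact (((measurable_labelVal.comp hy').smul hm).add hξ').prodMk hy'

lemma sampleLaw_linDist (n : ℕ) (μ : Feat d) (σ : ℝ) [IsProbabilityMeasure (junkLaw μ σ)] :
    sampleLaw n (linDist μ σ) =
      ((labelsLaw n).prod (junksLaw n μ σ)).map (fun p => mkSample μ p.1 p.2) := by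
  have hm : Measurable (fun q : ℤˣ × Feat d => (labelVal q.1 • μ + q.2, q.1)) :=
    (((measurable_labelVal.comp measurable_fst).smul_const μ).add measurable_snd).prodMk
      measurable_fst
  have : IsProbabilityMeasure ((labelLaw.prod (junkLaw μ σ)).map
      (fun q : ℤˣ × Feat d => (labelVal q.1 • μ + q.2, q.1))) :=
    Measure.isProbabilityMeasure_map hm.aemeasurable
  have h1 := measurePreserving_arrowProdEquivProdArrow ℤˣ (Feat d) (Fin n)
    (fun _ => labelLaw) (fun _ => junkLaw μ σ)
  rw [labelsLaw, junksLaw, ← h1.map_eq, Measure.map_map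
    (measurable_mkSample measurable_const measurable_fst measurable_snd) h1.measurable]
  rw [sampleLaw, linDist, ← Measure.pi_map_pi (fun _ => hm.aemeasurable)]
  rfl

end SampleLaw

/-! ### Measurability of the projection to a random span. -/

section MeasurableProjection

variable {d : ℕ}

/-- One Gram–Schmidt step. If the new vector already lies in `P`, then `r = 0` and the correction
vanishes, so no case distinction is needed. The explicit formula makes measurability inductive. -/
lemma starProjection_span_insert {ι : Type*} [DecidableEq ι] (f : ι → Feat d) (a : ι)
    (s : Finset ι) (x : Feat d) (P : Submodule ℝ (Feat d))
    (hP : P = Submodule.span ℝ (f '' s)) (r : Feat d) (hr : r = f a - P.starProjection (f a)) :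
    (Submodule.span ℝ (f '' (insert a s : Finset ι))).starProjection x =
      P.starProjection x + (inner ℝ x r / ‖r‖ ^ 2) • r := by
  have hle : P ≤ Submodule.span ℝ (f '' (insert a s : Finset ι)) := by
    rw [hP]
    exact Submodule.span_mono (Set.image_mono (by simp))
  have hrP : ∀ z ∈ P, inner ℝ r z = 0 := fun z hz => by
    rw [hr]; exact Submodule.starProjection_inner_eq_zero _ _ hz
  have hxP : ∀ z ∈ P, inner ℝ (x - P.starProjection x) z = 0 := fun z hz =>
    Submodule.starProjection_inner_eq_zero _ _ hz
  have ha : f a ∈ Submodule.span ℝ (f '' (insert a s : Finset ι)) :=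
    Submodule.subset_span ⟨a, by simp, rfl⟩
  apply Submodule.eq_starProjection_of_mem_of_inner_eq_zero
  · refine Submodule.add_mem _ (hle (Submodule.starProjection_apply_mem _ _))
      (Submodule.smul_mem _ _ ?_)
    rw [hr]
    exact Submodule.sub_mem _ ha (hle (Submodule.starProjection_apply_mem _ _))
  · intro w hw
    have hP0 : ∀ z ∈ P, inner ℝ (x - (P.starProjection x + (inner ℝ x r / ‖r‖ ^ 2) • r)) z = 0 := by
      intro z hz
      rw [← sub_sub, inner_sub_left, hxP z hz, inner_smul_left, hrP z hz]
      simp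
    induction hw using Submodule.span_induction with
    | mem z hz =>
      obtain ⟨i, hi, rfl⟩ := hz
      simp only [Finset.coe_insert, Set.mem_insert_iff, Finset.mem_coe] at hi
      by_cases his : i ∈ s
      · exact hP0 _ (hP ▸ Submodule.subset_span ⟨i, his, rfl⟩)
      · obtain rfl : i = a := hi.resolve_right his
        have hfa : f i = P.starProjection (f i) + r := by rw [hr]; abel
        rw [hfa, inner_add_right, hP0 _ (Submodule.starProjection_apply_mem _ _), zero_add,
          inner_sub_left, inner_add_left, inner_smul_left,
          real_inner_comm r (P.starProjection x), hrP _ (Submodule.starProjection_apply_mem _ _),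
          real_inner_self_eq_norm_sq]
        by_cases h0 : ‖r‖ = 0
        · rw [norm_eq_zero] at h0; simp [h0]
        · simp only [conj_trivial]
          field_simp
          ring
    | zero => simp
    | add y z _ _ hy hz => rw [inner_add_right, hy, hz, add_zero]
    | smul c y _ hy => rw [inner_smul_right, hy, mul_zero]

/-- The orthogonal projection to the span of finitely many random vectors is measurable. -/
lemma measurable_starProjection_span {Ω ι : Type*} [MeasurableSpace Ω] [DecidableEq ι]
    (f : Ω → ι → Feat d) (hf : ∀ i, Measurable fun ω => f ω i) (s : Finset ι)
    (g : Ω → Feat d) (hg : Measurable g) :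
    Measurable fun ω => (Submodule.span ℝ (f ω '' s)).starProjection (g ω) := by
  induction s using Finset.induction_on generalizing g with
  | empty => simp
  | insert a s _ ih =>
    have h : ∀ ω, (Submodule.span ℝ (f ω '' (insert a s : Finset ι))).starProjection (g ω) = _ :=
      fun ω => starProjection_span_insert (f ω) a s (g ω) _ rfl _ rfl
    simp_rw [h]
    have hr := (hf a).sub (ih _ (hf a))
    exact (ih _ hg).add (((hg.inner hr).div (hr.norm.pow_const 2)).smul hr)

end MeasurableProjection

/-! ### Dual vectors of the junk and the short separator, for fixed junk. -/

section DualVectors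

variable {d n : ℕ}

/-- The span of all junk components but the `i`-th. -/
noncomputable def otherSpan (ξ : Fin n → Feat d) (i : Fin n) : Submodule ℝ (Feat d) :=
  Submodule.span ℝ (ξ '' (Finset.univ.erase i : Finset (Fin n)))

lemma otherSpan_update (ξ : Fin n → Feat d) (i : Fin n) (t : Feat d) :
    otherSpan (Function.update ξ i t) i = otherSpan ξ i := by
  unfold otherSpan
  congr 1
  apply Set.image_congr
  intro j hj
  rw [Function.update_of_ne (by simpa using hj)]

lemma finrank_otherSpan_le (ξ : Fin n → Feat d) (i : Fin n) :
    Module.finrank ℝ (otherSpan ξ i) ≤ n := by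
  classical
  have h := finrank_span_finset_le_card (R := ℝ) ((Finset.univ.erase i).image ξ)
  rw [Finset.coe_image] at h
  refine h.trans (Finset.card_image_le.trans ?_)
  simp

lemma inner_eq_zero_of_mem_otherSpan {μ : Feat d} {ξ : Fin n → Feat d}
    (h : ∀ i, inner ℝ μ (ξ i) = 0) (i : Fin n) (x : Feat d) (hx : x ∈ otherSpan ξ i) :
    inner ℝ μ x = 0 := by
  rw [← Submodule.mem_orthogonal_singleton_iff_inner_right]
  refine Submodule.span_le.2 ?_ hx
  rintro _ ⟨j, _, rfl⟩
  exact Submodule.mem_orthogonal_singleton_iff_inner_right.2 (h j)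

/-- The component of the `i`-th junk vector orthogonal to the others. -/
noncomputable def junkResidual (ξ : Fin n → Feat d) (i : Fin n) : Feat d :=
  ξ i - (otherSpan ξ i).starProjection (ξ i)

lemma norm_residual_sq (ξ : Fin n → Feat d) (i : Fin n) :
    ‖junkResidual ξ i‖ ^ 2 = ‖ξ i‖ ^ 2 - ‖(otherSpan ξ i).starProjection (ξ i)‖ ^ 2 := by
  have h := Submodule.norm_sq_eq_add_norm_sq_starProjection (ξ i) (otherSpan ξ i)
  rw [Submodule.starProjection_orthogonal_val] at h
  rw [junkResidual, h]; ring

lemma inner_residual_of_ne (ξ : Fin n → Feat d) {i j : Fin n} (h : j ≠ i) :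
    inner ℝ (junkResidual ξ i) (ξ j) = 0 :=
  Submodule.starProjection_inner_eq_zero _ _ (Submodule.subset_span ⟨j, by simpa using h, rfl⟩)

lemma inner_residual_self (ξ : Fin n → Feat d) (i : Fin n) :
    inner ℝ (junkResidual ξ i) (ξ i) = ‖junkResidual ξ i‖ ^ 2 := by
  have h : ξ i = junkResidual ξ i + (otherSpan ξ i).starProjection (ξ i) := by rw [junkResidual]; abel
  have h0 : inner ℝ (junkResidual ξ i) ((otherSpan ξ i).starProjection (ξ i)) = 0 :=
    Submodule.starProjection_inner_eq_zero _ _ (Submodule.starProjection_apply_mem _ _)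
  calc inner ℝ (junkResidual ξ i) (ξ i)
      = inner ℝ (junkResidual ξ i) (junkResidual ξ i + (otherSpan ξ i).starProjection (ξ i)) :=
        congrArg _ h
    _ = ‖junkResidual ξ i‖ ^ 2 := by
        rw [inner_add_right, h0, add_zero, real_inner_self_eq_norm_sq]

/-- The dual vectors: `⟪dualVec ξ i, ξ j⟫ = δ_{ij}` in general position. -/
noncomputable def dualVec (ξ : Fin n → Feat d) (i : Fin n) : Feat d :=
  (‖junkResidual ξ i‖ ^ 2)⁻¹ • junkResidual ξ i

lemma inner_dualVec (ξ : Fin n → Feat d) {i : Fin n} (h : ‖junkResidual ξ i‖ ^ 2 ≠ 0) (j : Fin n) :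
    inner ℝ (dualVec ξ i) (ξ j) = if i = j then 1 else 0 := by
  rw [dualVec, inner_smul_left]
  split_ifs with hij
  · subst hij
    rw [inner_residual_self]
    exact inv_mul_cancel₀ h
  · rw [inner_residual_of_ne ξ (Ne.symm hij), mul_zero]

lemma norm_dualVec_sq (ξ : Fin n → Feat d) (i : Fin n) :
    ‖dualVec ξ i‖ ^ 2 = (‖junkResidual ξ i‖ ^ 2)⁻¹ := by
  rw [dualVec, norm_smul, mul_pow, norm_inv, norm_pow, norm_norm]
  by_cases h : ‖junkResidual ξ i‖ = 0
  · simp [h]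
  · field_simp

lemma inner_dualVec_eq_zero {μ : Feat d} {ξ : Fin n → Feat d}
    (h : ∀ i, inner ℝ μ (ξ i) = 0) (i : Fin n) : inner ℝ (dualVec ξ i) μ = 0 := by
  rw [dualVec, inner_smul_left, junkResidual, inner_sub_left, real_inner_comm, h i, real_inner_comm,
    inner_eq_zero_of_mem_otherSpan h i _ (Submodule.starProjection_apply_mem _ _)]
  simp

/-- Junk components orthogonal to the signal, of squared norm `R2`. -/
def IsJunkOf (μ : Feat d) (R2 : ℝ) (ξ : Fin n → Feat d) : Prop :=
  ∀ i, inner ℝ μ (ξ i) = 0 ∧ ‖ξ i‖ ^ 2 = R2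

/-- A direction orthogonal to the signal that classifies the junk components of a sample with
margin one and has squared norm at most `q`. -/
def HasJunkSeparator (μ : Feat d) (y : Fin n → ℤˣ) (ξ : Fin n → Feat d) (q : ℝ) : Prop :=
  ∃ W : Feat d, inner ℝ W μ = 0 ∧ (∀ i, labelVal (y i) * inner ℝ W (ξ i) = 1) ∧ ‖W‖ ^ 2 ≤ q

/-- For nearly orthogonal junk, `R2 • W` is close to `V`, where `W` and `V` are the signed sums of
the dual vectors and of the junk. Markov bounds their discrepancy, Chebyshev the fluctuation of
`‖V‖²`; the right side collects the two failure probabilities. -/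
lemma labels_bad_le (hn : 0 < n) (μ : Feat d) {R2 δ : ℝ} (hR : 0 < R2) (hδ : 0 < δ)
    (ξ : Fin n → Feat d) (hξ : IsJunkOf μ R2 ξ)
    (hhalf : ∀ i, ‖(otherSpan ξ i).starProjection (ξ i)‖ ^ 2 ≤ R2 / 2) :
    labelsLaw n {y | ¬ (‖signedSum Finset.univ ξ y‖ ^ 2 ≤ (1 + δ / 4) * (n * R2) ∧
      HasJunkSeparator μ y ξ ((1 + δ / 2) * (n / R2)))} ≤
      ENNReal.ofReal (8 / (δ * n * R2) * ∑ i, ‖(otherSpan ξ i).starProjection (ξ i)‖ ^ 2) +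
      ENNReal.ofReal (32 / (δ ^ 2 * n ^ 2 * R2 ^ 2) *
        ∑ i, ∑ j, if i = j then 0 else (inner ℝ (ξ i) (ξ j)) ^ 2) := by
  have hn' : (0 : ℝ) < n := by exact_mod_cast hn
  have hres : ∀ i, R2 / 2 ≤ ‖junkResidual ξ i‖ ^ 2 := fun i => by
    rw [norm_residual_sq, (hξ i).2]; linarith [hhalf i]
  have hres0 : ∀ i, ‖junkResidual ξ i‖ ^ 2 ≠ 0 := fun i => by
    have := hres i; linarith
  set W : (Fin n → ℤˣ) → Feat d := signedSum Finset.univ (dualVec ξ) with hW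
  set V : (Fin n → ℤˣ) → Feat d := signedSum Finset.univ ξ with hV
  have hWμ : ∀ y, inner ℝ (W y) μ = 0 := fun y => by
    simp only [hW, signedSum, sum_inner, inner_smul_left,
      inner_dualVec_eq_zero (fun i => (hξ i).1), mul_zero, Finset.sum_const_zero]
  have hWξ : ∀ y j, inner ℝ (W y) (ξ j) = labelVal (y j) := fun y j => by
    simp only [hW, signedSum, sum_inner, inner_smul_left, conj_trivial]
    rw [Finset.sum_congr rfl fun i _ => by rw [inner_dualVec ξ (hres0 i)]]
    simp
  have hsep : ∀ y q, ‖W y‖ ^ 2 ≤ q → HasJunkSeparator μ y ξ q := fun y q h =>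
    ⟨W y, hWμ y, fun i => by rw [hWξ, labelVal_mul_self], h⟩
  have hWV : ∀ y, inner ℝ (W y) (V y) = (n : ℝ) := fun y => by
    simp only [hV, signedSum, inner_sum, inner_smul_right, hWξ, labelVal_mul_self]
    simp
  -- Because `⟪W, V⟫ = n`, this is `‖R2 • W - V‖² / (n R2)`. It is thus nonnegative, and Markov
  -- applies although only first moments of `‖W‖²` and `‖V‖²` are available.
  set F : (Fin n → ℤˣ) → ℝ := fun y => R2 / n * ‖W y‖ ^ 2 + 1 / (n * R2) * ‖V y‖ ^ 2 - 2 with hF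
  set G : (Fin n → ℤˣ) → ℝ := fun y => (‖V y‖ ^ 2 - n * R2) ^ 2 with hG
  have hF0 : ∀ y, 0 ≤ F y := by
    intro y
    have h1 : 0 ≤ ‖R2 • W y - V y‖ ^ 2 := sq_nonneg _
    rw [norm_sub_sq_real, inner_smul_left, hWV, norm_smul, mul_pow, Real.norm_eq_abs, sq_abs] at h1
    simp only [conj_trivial] at h1
    have h2 : F y = (R2 ^ 2 * ‖W y‖ ^ 2 - 2 * (R2 * n) + ‖V y‖ ^ 2) / (n * R2) := by
      simp only [hF]
      field_simp
      ring
    rw [h2]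
    positivity
  have hEV : ∫ y, ‖V y‖ ^ 2 ∂labelsLaw n = n * R2 := by
    rw [hV, integral_norm_signedSum_sq]
    simp [(hξ _).2]
  have hEF : ∫ y, F y ∂labelsLaw n ≤
      2 / (n * R2) * ∑ i, ‖(otherSpan ξ i).starProjection (ξ i)‖ ^ 2 := by
    have h1 : ∫ y, F y ∂labelsLaw n = R2 / n * ∑ i, (‖junkResidual ξ i‖ ^ 2)⁻¹ - 1 := by
      simp only [hF]
      rw [integral_sub .of_finite .of_finite, integral_add .of_finite .of_finite,
        integral_const_mul, integral_const_mul, hEV, hW, integral_norm_signedSum_sq]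
      simp only [norm_dualVec_sq, integral_const, probReal_univ, one_smul]
      field_simp
      ring
    -- For `p ≤ R2/2`, one has `1/(R2 - p) ≤ 1/R2 + 2p/R2²`.
    have h2 : ∀ i ∈ Finset.univ, (‖junkResidual ξ i‖ ^ 2)⁻¹ ≤
        R2⁻¹ + 2 / R2 ^ 2 * ‖(otherSpan ξ i).starProjection (ξ i)‖ ^ 2 := by
      intro i _
      have h3 := hhalf i
      have h4 := norm_residual_sq ξ i
      rw [(hξ i).2] at h4
      have h5 : 0 ≤ ‖(otherSpan ξ i).starProjection (ξ i)‖ ^ 2 := sq_nonneg _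
      rw [h4]
      generalize ‖(otherSpan ξ i).starProjection (ξ i)‖ ^ 2 = p at *
      have h6 : R2⁻¹ + 2 / R2 ^ 2 * p = (R2 + 2 * p) / R2 ^ 2 := by field_simp
      rw [h6, inv_le_iff_one_le_mul₀ (by linarith), div_mul_eq_mul_div, one_le_div (by positivity)]
      nlinarith
    have h3 := Finset.sum_le_sum h2
    rw [Finset.sum_add_distrib, ← Finset.mul_sum] at h3
    simp only [Finset.sum_const, Finset.card_univ, Fintype.card_fin, nsmul_eq_mul] at h3
    rw [h1]
    have h4 := mul_le_mul_of_nonneg_left h3 (div_nonneg hR.le hn'.le)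
    have h5 : R2 / n * (n * R2⁻¹ + 2 / R2 ^ 2 * ∑ i, ‖(otherSpan ξ i).starProjection (ξ i)‖ ^ 2) =
        1 + 2 / (n * R2) * ∑ i, ‖(otherSpan ξ i).starProjection (ξ i)‖ ^ 2 := by
      field_simp
    linarith
  have hEG : ∫ y, G y ∂labelsLaw n =
      2 * ∑ i, ∑ j, if i = j then 0 else (inner ℝ (ξ i) (ξ j)) ^ 2 := by
    rw [← integral_norm_signedSum_sq_sub_sq]
    simp [hG, hV, (hξ _).2]
  have hsub : {y | ¬ (‖V y‖ ^ 2 ≤ (1 + δ / 4) * (n * R2) ∧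
      HasJunkSeparator μ y ξ ((1 + δ / 2) * (n / R2)))} ⊆
      {y | δ / 4 ≤ F y} ∪ {y | (δ / 4 * (n * R2)) ^ 2 ≤ G y} := by
    intro y hy
    by_contra hcon
    simp only [Set.mem_union, Set.mem_ofPred_eq, not_or, not_le] at hcon
    obtain ⟨h1, h2⟩ := hcon
    have h3 := abs_lt_of_sq_lt_sq h2 (by positivity)
    rw [abs_lt] at h3
    apply hy
    refine ⟨by linarith [h3.2], hsep y _ ?_⟩
    have h4 : 1 - δ / 4 < 1 / (n * R2) * ‖V y‖ ^ 2 := by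
      rw [one_div, inv_mul_eq_div, lt_div_iff₀ (by positivity)]
      linarith [h3.1]
    have h5 : R2 / n * ‖W y‖ ^ 2 < 1 + δ / 2 := by
      simp only [hF] at h1
      linarith
    have h6 : (1 + δ / 2) * (n / R2) = (n / R2) * (1 + δ / 2) := by ring
    rw [h6, ← div_le_iff₀' (by positivity)]
    refine le_trans (le_of_eq ?_) h5.le
    field_simp
  refine (measure_mono hsub).trans ((measure_union_le _ _).trans (add_le_add ?_ ?_))
  · have hm := mul_meas_ge_le_integral_of_nonneg (μ := labelsLaw n) (f := F)
      (Filter.Eventually.of_forall hF0) .of_finite (δ / 4)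
    rw [← ofReal_measureReal]
    apply ENNReal.ofReal_le_ofReal
    rw [← mul_le_mul_iff_right₀ (show 0 < δ / 4 by positivity)]
    refine (hm.trans hEF).trans (le_of_eq ?_)
    field_simp
    ring
  · have hm := mul_meas_ge_le_integral_of_nonneg (μ := labelsLaw n) (f := G)
      (Filter.Eventually.of_forall fun y => sq_nonneg _) .of_finite ((δ / 4 * (n * R2)) ^ 2)
    rw [← ofReal_measureReal]
    apply ENNReal.ofReal_le_ofReal
    rw [← mul_le_mul_iff_right₀ (show 0 < (δ / 4 * (n * R2)) ^ 2 by positivity)]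
    refine (hm.trans hEG.le).trans (le_of_eq ?_)
    field_simp
    ring

end DualVectors

/-! ### Averaging the label estimate over the junk. -/

section Concentration

variable {d n : ℕ}

lemma ae_isJunkOf (μ : Feat d) (hμ : ‖μ‖ = 1) (hd : 2 ≤ d) (σ : ℝ) :
    ∀ᵐ ξ ∂junksLaw n μ σ, IsJunkOf μ (((d : ℝ) - 1) * σ ^ 2) ξ := by
  have := isProbabilityMeasure_junkLaw μ hμ hd σ
  have hd' : (0 : ℝ) ≤ (d : ℝ) - 1 := by
    have : (2 : ℝ) ≤ d := by exact_mod_cast hd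
    linarith
  refine ae_all_iff.2 fun i => ?_
  have h := (Measure.quasiMeasurePreserving_eval (fun _ : Fin n => junkLaw μ σ) i).ae
    (ae_junkLaw μ σ)
  filter_upwards [h] with ξ hξ
  refine ⟨hξ.1, ?_⟩
  have h2 : ‖ξ i‖ = √((d : ℝ) - 1) * |σ| := hξ.2
  rw [h2, mul_pow, Real.sq_sqrt hd', sq_abs]

lemma measurable_starProjection_otherSpan (i : Fin n) :
    Measurable fun ξ : Fin n → Feat d => (otherSpan ξ i).starProjection (ξ i) :=
  measurable_starProjection_span (fun ξ : Fin n → Feat d => ξ) (fun j => measurable_pi_apply j)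
    (Finset.univ.erase i) _ (measurable_pi_apply i)

variable (μ : Feat d) (hμ : ‖μ‖ = 1) (hd : 2 ≤ d) {σ : ℝ}
include hμ hd

/-- The span of the other vectors does not involve `ξ i`, so resampling `ξ i` reduces to one junk
vector and a fixed subspace of dimension at most `n`. The next two lemmas use the same device. -/
lemma junksLaw_half_lt_le (hσ : 0 < σ) (hnd : 4 * (n : ℝ) ≤ (d : ℝ) - 1) (i : Fin n) :
    junksLaw n μ σ {ξ | ((d : ℝ) - 1) * σ ^ 2 / 2 < ‖(otherSpan ξ i).starProjection (ξ i)‖ ^ 2} ≤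
      ENNReal.ofReal (32 * n / ((d : ℝ) - 1) ^ 2) := by
  have := isProbabilityMeasure_junkLaw μ hμ hd σ
  have hpm : IsProbabilityMeasure (junksLaw n μ σ) := by unfold junksLaw; infer_instance
  have hm : MeasurableSet {ξ : Fin n → Feat d |
      ((d : ℝ) - 1) * σ ^ 2 / 2 < ‖(otherSpan ξ i).starProjection (ξ i)‖ ^ 2} :=
    measurableSet_lt measurable_const ((measurable_starProjection_otherSpan i).norm.pow_const 2)
  rw [← lintegral_indicator_one hm, junksLaw,
    lintegral_pi_resample _ i _ (measurable_one.indicator hm)]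
  change ∫⁻ x, _ ∂junksLaw n μ σ ≤ _
  calc _ ≤ ∫⁻ x, ENNReal.ofReal (32 * n / ((d : ℝ) - 1) ^ 2) ∂junksLaw n μ σ := by
        apply lintegral_mono_ae
        filter_upwards [ae_isJunkOf (n := n) μ hμ hd σ] with x hx
        have h := junkLaw_half_lt_starProjection μ hμ hd hσ (otherSpan x i)
          (inner_eq_zero_of_mem_otherSpan (fun j => (hx j).1) i) n
          (by exact_mod_cast finrank_otherSpan_le x i) hnd
        refine le_trans (le_of_eq ?_) h
        rw [← lintegral_indicator_one (measurableSet_lt measurable_const (by fun_prop))]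
        congr 1
        ext t
        simp only [Set.indicator, Set.mem_ofPred_eq, otherSpan_update, Function.update_self, Pi.one_apply]
    _ = _ := by simp

lemma lintegral_starProjection_otherSpan_le (i : Fin n) :
    ∫⁻ ξ, ENNReal.ofReal (‖(otherSpan ξ i).starProjection (ξ i)‖ ^ 2) ∂junksLaw n μ σ ≤
      ENNReal.ofReal (n * σ ^ 2) := by
  have := isProbabilityMeasure_junkLaw μ hμ hd σ
  have hpm : IsProbabilityMeasure (junksLaw n μ σ) := by unfold junksLaw; infer_instance
  rw [junksLaw, lintegral_pi_resample _ i _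
    ((measurable_starProjection_otherSpan i).norm.pow_const 2).ennreal_ofReal]
  change ∫⁻ x, _ ∂junksLaw n μ σ ≤ _
  calc _ ≤ ∫⁻ x, ENNReal.ofReal (n * σ ^ 2) ∂junksLaw n μ σ := by
        apply lintegral_mono_ae
        filter_upwards [ae_isJunkOf (n := n) μ hμ hd σ] with x hx
        have h := (integral_norm_starProjection μ hμ hd σ (otherSpan x i)
          (inner_eq_zero_of_mem_otherSpan (fun j => (hx j).1) i)).1
        have hu : ∀ t, ‖(otherSpan (Function.update x i t) i).starProjection
            (Function.update x i t i)‖ = ‖(otherSpan x i).starProjection t‖ := fun t => by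
          rw [otherSpan_update, Function.update_self]
        simp_rw [hu]
        rw [← ofReal_integral_eq_lintegral_ofReal (integrable_junkLaw μ σ _ (by fun_prop))
          (Filter.Eventually.of_forall fun _ => sq_nonneg _), h]
        apply ENNReal.ofReal_le_ofReal
        have : (Module.finrank ℝ (otherSpan x i) : ℝ) ≤ n := by
          exact_mod_cast finrank_otherSpan_le x i
        gcongr
    _ = _ := by simp

lemma lintegral_inner_sq_le {i j : Fin n} (hij : i ≠ j) :
    ∫⁻ ξ, ENNReal.ofReal ((inner ℝ (ξ i) (ξ j)) ^ 2) ∂junksLaw n μ σ ≤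
      ENNReal.ofReal (((d : ℝ) - 1) * σ ^ 2 * σ ^ 2) := by
  have := isProbabilityMeasure_junkLaw μ hμ hd σ
  have hpm : IsProbabilityMeasure (junksLaw n μ σ) := by unfold junksLaw; infer_instance
  have hm : Measurable fun ξ : Fin n → Feat d => ENNReal.ofReal ((inner ℝ (ξ i) (ξ j)) ^ 2) :=
    (((measurable_pi_apply i).inner (measurable_pi_apply j)).pow_const 2).ennreal_ofReal
  rw [junksLaw, lintegral_pi_resample _ j _ hm]
  change ∫⁻ x, _ ∂junksLaw n μ σ ≤ _
  calc _ ≤ ∫⁻ x, ENNReal.ofReal (((d : ℝ) - 1) * σ ^ 2 * σ ^ 2) ∂junksLaw n μ σ := by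
        apply lintegral_mono_ae
        filter_upwards [ae_isJunkOf (n := n) μ hμ hd σ] with x hx
        simp only [Function.update_self, Function.update_of_ne hij]
        rw [← ofReal_integral_eq_lintegral_ofReal (integrable_junkLaw μ σ _ (by fun_prop))
          (Filter.Eventually.of_forall fun _ => sq_nonneg _),
          integral_inner_sq μ hμ hd σ _ (hx i).1, (hx i).2]
    _ = _ := by simp

/-- With high probability the junk components have a short separator and their signed sum is not
longer than expected. -/
lemma labels_junks_bad_le (hσ : 0 < σ) (hn : 0 < n) (hnd : 4 * (n : ℝ) ≤ (d : ℝ) - 1) {δ : ℝ}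
    (hδ : 0 < δ) (B : Set ((Fin n → ℤˣ) × (Fin n → Feat d))) (hB : MeasurableSet B)
    (hgood : ∀ y ξ, IsJunkOf μ (((d : ℝ) - 1) * σ ^ 2) ξ →
      ‖signedSum Finset.univ ξ y‖ ^ 2 ≤ (1 + δ / 4) * (n * (((d : ℝ) - 1) * σ ^ 2)) →
      HasJunkSeparator μ y ξ ((1 + δ / 2) * (n / (((d : ℝ) - 1) * σ ^ 2))) → (y, ξ) ∈ B) :
    ((labelsLaw n).prod (junksLaw n μ σ)) Bᶜ ≤
      ENNReal.ofReal (32 * n ^ 2 / ((d : ℝ) - 1) ^ 2) + ENNReal.ofReal (8 * n / (δ * ((d : ℝ) - 1)))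
        + ENNReal.ofReal (32 / (δ ^ 2 * ((d : ℝ) - 1))) := by
  have := isProbabilityMeasure_junkLaw μ hμ hd σ
  have hpm : IsProbabilityMeasure (junksLaw n μ σ) := by unfold junksLaw; infer_instance
  have hn' : (0 : ℝ) < n := by exact_mod_cast hn
  have hd' : (0 : ℝ) < (d : ℝ) - 1 := by linarith
  set D := (d : ℝ) - 1 with hD
  set R2 := D * σ ^ 2 with hR2
  have hR : 0 < R2 := by positivity
  set C : Set (Fin n → Feat d) :=
    ⋃ i, {ξ | R2 / 2 < ‖(otherSpan ξ i).starProjection (ξ i)‖ ^ 2} with hC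
  have hCm : MeasurableSet C := MeasurableSet.iUnion fun i =>
    measurableSet_lt measurable_const ((measurable_starProjection_otherSpan i).norm.pow_const 2)
  set a := 8 / (δ * n * R2) with ha
  set b := 32 / (δ ^ 2 * n ^ 2 * R2 ^ 2) with hb
  have ha0 : 0 ≤ a := by positivity
  have hb0 : 0 ≤ b := by positivity
  set f1 : (Fin n → Feat d) → ENNReal := fun ξ =>
    ∑ i, ENNReal.ofReal (‖(otherSpan ξ i).starProjection (ξ i)‖ ^ 2) with hf1
  set f2 : (Fin n → Feat d) → ENNReal := fun ξ =>
    ∑ i, ∑ j, if i = j then 0 else ENNReal.ofReal ((inner ℝ (ξ i) (ξ j)) ^ 2) with hf2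
  have hm1 : ∀ i : Fin n, Measurable fun ξ : Fin n → Feat d =>
      ENNReal.ofReal (‖(otherSpan ξ i).starProjection (ξ i)‖ ^ 2) := fun i =>
    ((measurable_starProjection_otherSpan i).norm.pow_const 2).ennreal_ofReal
  have hm2 : ∀ i j : Fin n, Measurable fun ξ : Fin n → Feat d =>
      if i = j then 0 else ENNReal.ofReal ((inner ℝ (ξ i) (ξ j)) ^ 2) := fun i j => by
    split_ifs
    · exact measurable_const
    · exact (((measurable_pi_apply i).inner (measurable_pi_apply j)).pow_const 2).ennreal_ofReal
  have hf1m : Measurable f1 := Finset.measurable_fun_sum _ fun i _ => hm1 i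
  have hf2m : Measurable f2 :=
    Finset.measurable_fun_sum _ fun i _ => Finset.measurable_fun_sum _ fun j _ => hm2 i j
  -- Existence of a separator is not known to be a measurable event; the measurable set `B`
  -- containing the good pairs stands in for it, so that the labels can be integrated out first.
  rw [Measure.prod_apply_symm hB.compl]
  calc ∫⁻ ξ, labelsLaw n ((fun y => (y, ξ)) ⁻¹' Bᶜ) ∂junksLaw n μ σ
      ≤ ∫⁻ ξ, (C.indicator 1 ξ + (ENNReal.ofReal a * f1 ξ + ENNReal.ofReal b * f2 ξ))
          ∂junksLaw n μ σ := by
        apply lintegral_mono_ae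
        filter_upwards [ae_isJunkOf (n := n) μ hμ hd σ] with ξ hξ
        by_cases hξC : ξ ∈ C
        · rw [Set.indicator_of_mem hξC]
          exact prob_le_one.trans le_self_add
        · rw [Set.indicator_of_notMem hξC, zero_add]
          have hhalf : ∀ i, ‖(otherSpan ξ i).starProjection (ξ i)‖ ^ 2 ≤ R2 / 2 := by
            intro i
            by_contra hcon
            exact hξC (Set.mem_iUnion.2 ⟨i, not_le.1 hcon⟩)
          refine (measure_mono ?_).trans ((labels_bad_le hn μ hR hδ ξ hξ hhalf).trans
            (le_of_eq ?_))
          · intro y hy hcon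
            exact hy (hgood y ξ hξ hcon.1 hcon.2)
          · rw [ENNReal.ofReal_mul ha0, ENNReal.ofReal_mul hb0,
              ENNReal.ofReal_sum_of_nonneg fun i _ => sq_nonneg _,
              ENNReal.ofReal_sum_of_nonneg fun i _ => Finset.sum_nonneg fun j _ => by
                split_ifs <;> positivity]
            congr 2
            refine Finset.sum_congr rfl fun i _ => ?_
            rw [ENNReal.ofReal_sum_of_nonneg fun j _ => by split_ifs <;> positivity]
            refine Finset.sum_congr rfl fun j _ => ?_
            split_ifs <;> simp
    _ = junksLaw n μ σ C + (ENNReal.ofReal a * ∫⁻ ξ, f1 ξ ∂junksLaw n μ σ +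
          ENNReal.ofReal b * ∫⁻ ξ, f2 ξ ∂junksLaw n μ σ) := by
        rw [lintegral_add_left (measurable_one.indicator hCm), lintegral_indicator_one hCm,
          lintegral_add_left (hf1m.const_mul _), lintegral_const_mul _ hf1m,
          lintegral_const_mul _ hf2m]
    _ ≤ ENNReal.ofReal (32 * n ^ 2 / D ^ 2) + (ENNReal.ofReal a * ENNReal.ofReal (n * (n * σ ^ 2)) +
          ENNReal.ofReal b * ENNReal.ofReal (n * (n * (D * σ ^ 2 * σ ^ 2)))) := by
        gcongr
        · refine (measure_iUnion_fintype_le _ _).trans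
            ((Finset.sum_le_sum fun i _ => junksLaw_half_lt_le μ hμ hd hσ hnd i).trans ?_)
          rw [Finset.sum_const, Finset.card_univ, Fintype.card_fin, nsmul_eq_mul,
            ← ENNReal.ofReal_natCast, ← ENNReal.ofReal_mul hn'.le]
          apply ENNReal.ofReal_le_ofReal
          apply le_of_eq
          ring
        · rw [hf1, lintegral_finsetSum _ fun i _ => hm1 i]
          refine (Finset.sum_le_sum fun i _ =>
            lintegral_starProjection_otherSpan_le μ hμ hd i).trans ?_
          rw [Finset.sum_const, Finset.card_univ, Fintype.card_fin, nsmul_eq_mul,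
            ← ENNReal.ofReal_natCast, ← ENNReal.ofReal_mul hn'.le]
        · rw [hf2, lintegral_finsetSum _ fun i _ => Finset.measurable_fun_sum _ fun j _ => hm2 i j]
          have h1 : ∀ i ∈ Finset.univ, ∫⁻ ξ : Fin n → Feat d,
              (∑ j, if i = j then 0 else ENNReal.ofReal ((inner ℝ (ξ i) (ξ j)) ^ 2))
                ∂junksLaw n μ σ ≤ ENNReal.ofReal (n * (D * σ ^ 2 * σ ^ 2)) := by
            intro i _
            rw [lintegral_finsetSum _ fun j _ => hm2 i j]
            have h2 : ∀ j ∈ Finset.univ, ∫⁻ ξ : Fin n → Feat d,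
                (if i = j then 0 else ENNReal.ofReal ((inner ℝ (ξ i) (ξ j)) ^ 2))
                  ∂junksLaw n μ σ ≤ ENNReal.ofReal (D * σ ^ 2 * σ ^ 2) := by
              intro j _
              split_ifs with hij
              · simp
              · exact lintegral_inner_sq_le μ hμ hd hij
            refine (Finset.sum_le_sum h2).trans ?_
            rw [Finset.sum_const, Finset.card_univ, Fintype.card_fin, nsmul_eq_mul,
              ← ENNReal.ofReal_natCast, ← ENNReal.ofReal_mul hn'.le]
          refine (Finset.sum_le_sum h1).trans ?_
          rw [Finset.sum_const, Finset.card_univ, Fintype.card_fin, nsmul_eq_mul,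
            ← ENNReal.ofReal_natCast, ← ENNReal.ofReal_mul hn'.le]
    _ = _ := by
        rw [← ENNReal.ofReal_mul ha0, ← ENNReal.ofReal_mul hb0, ← add_assoc]
        have e1 : a * (n * (n * σ ^ 2)) = 8 * n / (δ * D) := by
          rw [ha, hR2]; field_simp
        have e2 : b * (n * (n * (D * σ ^ 2 * σ ^ 2))) = 32 / (δ ^ 2 * D) := by
          rw [hb, hR2]; field_simp
        rw [e1, e2]

end Concentration

/-! ### Margins, the labelled mean and the maximum margin. -/

section Margins

variable {d n : ℕ}

/-- The average of the examples multiplied by their labels. -/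
noncomputable def labelledMean (S : Sample n d) : Feat d :=
  (n : ℝ)⁻¹ • ∑ i, labelVal (S i).2 • (S i).1

lemma margin_le (w : Feat d) (S : Sample n d) (i : Fin n) :
    margin w S ≤ labelVal (S i).2 * linPred w (S i).1 :=
  ciInf_le (Set.finite_range _).bddBelow i

/-- A minimum is at most the average. This is the source of every upper bound on margins. -/
lemma margin_le_inner_labelledMean (hn : 0 < n) (w : Feat d) (S : Sample n d) :
    margin w S ≤ inner ℝ w (labelledMean S) := by
  have hn' : (0 : ℝ) < n := by exact_mod_cast hn
  have h := Finset.sum_le_sum fun i (_ : i ∈ Finset.univ) => margin_le w S i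
  simp only [Finset.sum_const, Finset.card_univ, Fintype.card_fin, nsmul_eq_mul] at h
  rw [labelledMean, inner_smul_right, inner_sum, inv_mul_eq_div, le_div_iff₀ hn', mul_comm]
  simpa only [inner_smul_right, linPred] using h

lemma margin_le_norm_labelledMean (hn : 0 < n) {w : Feat d} (hw : ‖w‖ ≤ 1) (S : Sample n d) :
    margin w S ≤ ‖labelledMean S‖ :=
  (margin_le_inner_labelledMean hn w S).trans ((real_inner_le_norm _ _).trans
    (mul_le_of_le_one_left (norm_nonneg _) hw))

lemma maxMargin_le (hn : 0 < n) (S : Sample n d) : maxMargin S ≤ ‖labelledMean S‖ :=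
  have : Nonempty (Metric.closedBall (0 : Feat d) 1) := ⟨⟨0, by simp⟩⟩
  ciSup_le fun w => margin_le_norm_labelledMean hn (mem_closedBall_zero_iff.1 w.2) S

lemma margin_le_maxMargin (hn : 0 < n) {w : Feat d} (hw : ‖w‖ ≤ 1) (S : Sample n d) :
    margin w S ≤ maxMargin S :=
  le_ciSup (f := fun w : Metric.closedBall (0 : Feat d) 1 => margin (w : Feat d) S)
    ⟨‖labelledMean S‖, by
      rintro _ ⟨v, rfl⟩
      exact margin_le_norm_labelledMean hn (mem_closedBall_zero_iff.1 v.2) S⟩ ⟨w, by simpa using hw⟩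

lemma labelVal_mul_linPred_mkSample (w m : Feat d) (y : Fin n → ℤˣ) (ξ : Fin n → Feat d)
    (i : Fin n) :
    labelVal (mkSample m y ξ i).2 * linPred w (mkSample m y ξ i).1 =
      inner ℝ w m + labelVal (y i) * inner ℝ w (ξ i) := by
  simp only [mkSample, linPred, inner_add_right, inner_smul_right]
  linear_combination (inner ℝ w m) * labelVal_mul_self (y i)

/-- Changing the signal of a sample changes all its margins by the same amount. -/
lemma margin_mkSample_sub_le (hn : 0 < n) (w m m' : Feat d) (y : Fin n → ℤˣ)
    (ξ : Fin n → Feat d) :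
    margin w (mkSample m y ξ) - inner ℝ w m + inner ℝ w m' ≤ margin w (mkSample m' y ξ) := by
  have : Nonempty (Fin n) := ⟨⟨0, hn⟩⟩
  refine le_ciInf fun i => ?_
  have h := margin_le w (mkSample m y ξ) i
  rw [labelVal_mul_linPred_mkSample] at h ⊢
  linarith

lemma sqrt_le_maxMargin (hn : 0 < n) {μ : Feat d} (hμ : ‖μ‖ = 1) {y : Fin n → ℤˣ}
    {ξ : Fin n → Feat d} (hξ : ∀ i, inner ℝ μ (ξ i) = 0) {q : ℝ} (hq : 0 < q)
    (h : HasJunkSeparator μ y ξ q) : √(1 + q⁻¹) ≤ maxMargin (mkSample μ y ξ) := by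
  obtain ⟨W, hWμ, hW, hWq⟩ := h
  have : Nonempty (Fin n) := ⟨⟨0, hn⟩⟩
  have hpos : 0 < 1 + q⁻¹ := by positivity
  set t := √(1 + q⁻¹) with ht
  have ht0 : 0 < t := Real.sqrt_pos.2 hpos
  have ht2 : t ^ 2 = 1 + q⁻¹ := Real.sq_sqrt hpos.le
  -- Both `μ` and `W` give margin one, and they are orthogonal with squared norms `1` and at most
  -- `q`. The weights `1 : q⁻¹` maximize the margin per norm when `‖W‖² = q`, and the resulting
  -- margin is exactly `t`.
  set w : Feat d := t⁻¹ • (μ + q⁻¹ • W) with hw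
  have hn2 : ‖μ + q⁻¹ • W‖ ^ 2 ≤ t ^ 2 := by
    rw [norm_add_sq_real, hμ, inner_smul_right, real_inner_comm, hWμ, norm_smul, mul_pow, ht2,
      Real.norm_eq_abs, sq_abs]
    have : q⁻¹ ^ 2 * ‖W‖ ^ 2 ≤ q⁻¹ ^ 2 * q := by gcongr
    have h2 : q⁻¹ ^ 2 * q = q⁻¹ := by field_simp
    linarith
  have hw1 : ‖w‖ ≤ 1 := by
    rw [hw, norm_smul, norm_inv, Real.norm_of_nonneg ht0.le, inv_mul_le_iff₀ ht0, mul_one]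
    exact (sq_le_sq₀ (norm_nonneg _) ht0.le).1 hn2
  refine le_trans ?_ (margin_le_maxMargin hn hw1 _)
  refine le_ciInf fun i => ?_
  rw [labelVal_mul_linPred_mkSample]
  apply le_of_eq
  have h1 : inner ℝ w μ = t⁻¹ := by
    rw [hw, inner_smul_left, inner_add_left, inner_smul_left, hWμ, real_inner_self_eq_norm_sq, hμ]
    simp
  have h2 : inner ℝ w (ξ i) = t⁻¹ * (q⁻¹ * inner ℝ W (ξ i)) := by
    rw [hw, inner_smul_left, inner_add_left, inner_smul_left, hξ i]
    simp
  rw [h1, h2]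
  have h3 : t⁻¹ + labelVal (y i) * (t⁻¹ * (q⁻¹ * inner ℝ W (ξ i))) = t⁻¹ * t ^ 2 := by
    rw [ht2]
    linear_combination (t⁻¹ * q⁻¹) * hW i
  rw [h3]
  field_simp

lemma labelledMean_mkSample (hn : 0 < n) (μ : Feat d) (y : Fin n → ℤˣ) (ξ : Fin n → Feat d) :
    labelledMean (mkSample μ y ξ) = μ + (n : ℝ)⁻¹ • signedSum Finset.univ ξ y := by
  have hn' : (n : ℝ) ≠ 0 := by exact_mod_cast hn.ne'
  simp only [labelledMean, mkSample, smul_add, smul_smul, labelVal_mul_self, one_smul,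
    Finset.sum_add_distrib, signedSum]
  simp only [Finset.sum_const, Finset.card_univ, Fintype.card_fin]
  rw [← Nat.cast_smul_eq_nsmul ℝ, smul_smul, inv_mul_cancel₀ hn', one_smul]

lemma inner_signedSum_eq_zero {e : Feat d} {ξ : Fin n → Feat d} (h : ∀ i, inner ℝ e (ξ i) = 0)
    (y : Fin n → ℤˣ) : inner ℝ e (signedSum Finset.univ ξ y) = 0 := by
  simp [signedSum, inner_sum, inner_smul_right, h]

lemma norm_labelledMean_mkSample_sq (hn : 0 < n) {μ : Feat d} (hμ : ‖μ‖ = 1) (y : Fin n → ℤˣ)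
    {ξ : Fin n → Feat d} (hξ : ∀ i, inner ℝ μ (ξ i) = 0) :
    ‖labelledMean (mkSample μ y ξ)‖ ^ 2 = 1 + ‖signedSum Finset.univ ξ y‖ ^ 2 / n ^ 2 := by
  rw [labelledMean_mkSample hn, norm_add_sq_real, inner_smul_right, inner_signedSum_eq_zero hξ,
    hμ, norm_smul, mul_pow, norm_inv, Real.norm_natCast]
  ring

/-- The components of a classifier of nearly maximal margin are close to those of the normalized
labelled mean. -/
lemma abs_inner_sub_le (hn : 0 < n) {w e : Feat d} (hw : ‖w‖ ≤ 1) (he : ‖e‖ ≤ 1)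
    {S : Sample n d} {T τ : ℝ} (hT : 0 < T) (hS : ‖labelledMean S‖ ≤ T)
    (hm : (1 - τ) * T ≤ margin w S) :
    |inner ℝ w e - inner ℝ (labelledMean S) e / T| ≤ √(2 * τ) := by
  have h1 := hm.trans (margin_le_inner_labelledMean hn w S)
  set g := labelledMean S
  -- Two vectors of the unit ball with inner product at least `1 - τ` are at squared distance at
  -- most `2τ`.
  have h2 : ‖w - T⁻¹ • g‖ ^ 2 ≤ 2 * τ := by
    rw [norm_sub_sq_real, inner_smul_right, norm_smul, mul_pow, norm_inv,
      Real.norm_of_nonneg hT.le]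
    have h3 : ‖w‖ ^ 2 ≤ 1 := pow_le_one₀ (norm_nonneg _) hw
    have h4 : T⁻¹ ^ 2 * ‖g‖ ^ 2 ≤ 1 := by
      rw [inv_pow, inv_mul_le_iff₀ (by positivity), mul_one]
      exact pow_le_pow_left₀ (norm_nonneg _) hS 2
    have h5 : 1 - τ ≤ T⁻¹ * inner ℝ w g := by
      rw [inv_mul_eq_div, le_div_iff₀ hT]; exact h1
    linarith
  have h3 : inner ℝ w e - inner ℝ g e / T = inner ℝ (w - T⁻¹ • g) e := by
    rw [inner_sub_left, inner_smul_left]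
    simp only [conj_trivial]
    ring
  rw [h3]
  refine (abs_real_inner_le_norm _ _).trans ?_
  exact (mul_le_of_le_one_right (norm_nonneg _) he).trans (Real.le_sqrt_of_sq_le h2)

end Margins

/-! ### Test loss in terms of the correlation with the signal. -/

section Losses

variable {d n : ℕ}

lemma zeroOneLoss_labelVal (a : ℝ) (y : ℤˣ) :
    zeroOneLoss a (labelVal y) = if labelVal y * a ≤ 0 then 1 else 0 := by
  rw [zeroOneLoss]
  rcases Int.units_eq_one_or y with rfl | rfl
  · rcases lt_trichotomy a 0 with h | h | h
    · simp [labelVal, sign_neg h, h.le]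
    · simp [labelVal, h]
    · simp [labelVal, sign_pos h, h.not_ge]
  · rcases lt_trichotomy a 0 with h | h | h
    · simp [labelVal, sign_neg h, h.not_ge]
    · simp [labelVal, h]
    · simp [labelVal, sign_pos h, h.le]

lemma empLoss_eq_zero {w : Feat d} {S : Sample n d} (h : 0 < margin w S) : empLoss S w = 0 := by
  rw [empLoss]
  rw [Finset.sum_eq_zero, mul_zero]
  intro i _
  rw [zeroOneLoss_labelVal, if_neg (h.trans_le (margin_le w S i)).not_ge]

lemma measurable_labelVal_mul_inner (w m : Feat d) :
    Measurable fun q : ℤˣ × Feat d => inner ℝ w m + labelVal q.1 * inner ℝ w q.2 :=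
  measurable_const.add ((measurable_labelVal.comp measurable_fst).mul
    (measurable_const.inner measurable_snd))

lemma testLoss_linDist (m w : Feat d) (σ : ℝ) :
    testLoss (linDist m σ) w =
      (labelLaw.prod (junkLaw m σ)).real {q | inner ℝ w m + labelVal q.1 * inner ℝ w q.2 ≤ 0} := by
  have hm : Measurable (fun q : ℤˣ × Feat d => (labelVal q.1 • m + q.2, q.1)) :=
    (((measurable_labelVal.comp measurable_fst).smul_const m).add measurable_snd).prodMk
      measurable_fst
  have hs : MeasurableSet {z : Example d | labelVal z.2 * linPred w z.1 ≤ 0} :=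
    measurableSet_le ((measurable_labelVal.comp measurable_snd).mul
      (measurable_const.inner measurable_fst)) measurable_const
  have h1 : ∀ z : Example d, zeroOneLoss (linPred w z.1) (labelVal z.2) =
      {z : Example d | labelVal z.2 * linPred w z.1 ≤ 0}.indicator 1 z := by
    intro z
    rw [zeroOneLoss_labelVal]
    simp [Set.indicator]
  rw [testLoss, integral_congr_ae (Filter.Eventually.of_forall h1), integral_indicator_one hs,
    linDist, map_measureReal_apply hm hs]
  congr 1
  ext q
  simp only [Set.mem_preimage, Set.mem_ofPred_eq, linPred, inner_add_right, inner_smul_right]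
  have : labelVal q.1 * (labelVal q.1 * inner ℝ w m + inner ℝ w q.2) =
      inner ℝ w m + labelVal q.1 * inner ℝ w q.2 := by
    linear_combination (inner ℝ w m) * labelVal_mul_self q.1
  rw [this]

lemma half_le_labelLaw {s : Set ℤˣ} {y : ℤˣ} (h : y ∈ s) : 2⁻¹ ≤ labelLaw s := by
  refine le_trans ?_ (measure_mono (Set.singleton_subset_iff.2 h))
  rcases Int.units_eq_one_or y with rfl | rfl <;> simp [labelLaw]

/-- A classifier that is not positively correlated with the signal is no better than guessing. -/
lemma half_le_testLoss (m w : Feat d) (σ : ℝ) [IsProbabilityMeasure (junkLaw m σ)]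
    (h : inner ℝ w m ≤ 0) : 1 / 2 ≤ testLoss (linDist m σ) w := by
  have hs : MeasurableSet {q : ℤˣ × Feat d | inner ℝ w m + labelVal q.1 * inner ℝ w q.2 ≤ 0} :=
    measurableSet_le (measurable_labelVal_mul_inner w m) measurable_const
  have h1 : 2⁻¹ ≤ (labelLaw.prod (junkLaw m σ))
      {q | inner ℝ w m + labelVal q.1 * inner ℝ w q.2 ≤ 0} := by
    rw [Measure.prod_apply_symm hs]
    calc (2⁻¹ : ENNReal) = ∫⁻ _, 2⁻¹ ∂junkLaw m σ := by simp
      _ ≤ _ := by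
        apply lintegral_mono
        intro ξ
        -- For each junk vector at least one of the two labels makes the junk contribution
        -- nonpositive, and that label has mass `1/2`.
        rcases le_total (inner ℝ w ξ) 0 with h0 | h0
        · apply half_le_labelLaw (y := 1)
          simp [labelVal]
          linarith
        · apply half_le_labelLaw (y := -1)
          simp [labelVal]
          linarith
  rw [testLoss_linDist]
  have := ENNReal.toReal_mono (measure_ne_top _ _) h1
  simpa [Measure.real] using this

/-- A classifier that is negatively correlated with the signal is almost always wrong. -/
lemma testLoss_neg_ge (μ : Feat d) (hμ : ‖μ‖ = 1) (hd : 2 ≤ d) {σ : ℝ} (hσ : 0 < σ) (w : Feat d)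
    (hw : ‖w‖ ≤ 1) (ha : 0 < inner ℝ w μ)
    (h2 : (inner ℝ w μ) ^ 2 ≤ ((d : ℝ) - 1) * σ ^ 2 / 2) :
    1 - Real.exp (-((inner ℝ w μ) ^ 2 / (2 * σ ^ 2))) ≤ testLoss (linDist (-μ) σ) w := by
  have hμ' : ‖-μ‖ = 1 := by rwa [norm_neg]
  have := isProbabilityMeasure_junkLaw (-μ) hμ' hd σ
  have hs : MeasurableSet {q : ℤˣ × Feat d |
      inner ℝ w (-μ) + labelVal q.1 * inner ℝ w q.2 ≤ 0} :=
    measurableSet_le (measurable_labelVal_mul_inner w (-μ)) measurable_const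
  rw [testLoss_linDist, ← compl_compl {q : ℤˣ × Feat d |
      inner ℝ w (-μ) + labelVal q.1 * inner ℝ w q.2 ≤ 0}, probReal_compl_eq_one_sub hs.compl]
  apply sub_le_sub_left
  apply ENNReal.toReal_le_of_le_ofReal (Real.exp_pos _).le
  rw [Measure.prod_apply hs.compl]
  calc _ ≤ ∫⁻ _, ENNReal.ofReal (Real.exp (-((inner ℝ w μ) ^ 2 / (2 * σ ^ 2)))) ∂labelLaw := by
        apply lintegral_mono
        intro y
        have hy : ‖labelVal y • w‖ ≤ 1 := by
          rw [norm_smul]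
          rcases Int.units_eq_one_or y with rfl | rfl <;> simpa [labelVal] using hw
        refine le_trans (measure_mono ?_) (junkLaw_tail (-μ) hμ' hd hσ (labelVal y • w) hy ha h2)
        intro ξ hξ
        simp only [Set.mem_preimage, Set.mem_compl_iff, Set.mem_ofPred_eq, not_le,
          inner_neg_right] at hξ
        simp only [Set.mem_ofPred_eq, inner_smul_left, conj_trivial]
        linarith
    _ = _ := by simp

end Losses

/-! ### The parameter regime and the probability of a typical margin. -/

section GoodSamples

variable {d n : ℕ}

lemma le_of_sq_le_sq_of_nonneg {a b : ℝ} (h : a ^ 2 ≤ b ^ 2) (hb : 0 ≤ b) : a ≤ b :=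
  le_of_abs_le (abs_le_of_sq_le_sq h hb)

/-- The typical size of the maximum margin. -/
noncomputable def marginScale (κ : ℝ) : ℝ := √(1 + (1 + κ / 200) / κ)

/-- The samples on which the maximum margin has its typical size. -/
def goodSamples (A : Sample n d → Feat d) (κ : ℝ) : Set (Sample n d) :=
  {S | ‖labelledMean S‖ ≤ marginScale κ ∧ (1 - κ / 50) * marginScale κ ≤ margin (A S) S}

/-- The parameter regime: `κ` is the ratio `n / (d σ²)`, less than one, and the dimension is
large. -/
structure IsRegime (n d : ℕ) (σ κ : ℝ) : Prop where
  n_pos : 0 < n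
  sigma_pos : 0 < σ
  kappa_pos : 0 < κ
  kappa_lt : κ < 1
  eq : κ * (d * σ ^ 2) = n
  large : 10 ^ 8 * (n : ℝ) ≤ d * κ ^ 2

lemma marginScale_sq {κ : ℝ} (hκ : 0 < κ) : marginScale κ ^ 2 = 1 + (1 + κ / 200) / κ :=
  Real.sq_sqrt (by positivity)

lemma marginScale_pos {κ : ℝ} (hκ : 0 < κ) : 0 < marginScale κ := Real.sqrt_pos.2 (by positivity)

lemma marginScale_sq_mul {κ : ℝ} (hκ : 0 < κ) : marginScale κ ^ 2 * κ = 1 + κ + κ / 200 := by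
  rw [marginScale_sq hκ]; field_simp; ring

namespace IsRegime

variable {σ κ : ℝ} (h : IsRegime n d σ κ)
include h

lemma one_le_n : (1 : ℝ) ≤ n := by exact_mod_cast h.n_pos

lemma large' : 10 ^ 8 * (n : ℝ) ≤ d := by
  have h1 := h.large
  have h2 : κ ^ 2 ≤ 1 := pow_le_one₀ h.kappa_pos.le h.kappa_lt.le
  have h3 : (d : ℝ) * κ ^ 2 ≤ d := mul_le_of_le_one_right (Nat.cast_nonneg _) h2
  linarith

lemma two_le_d : 2 ≤ d := by
  have h1 := h.large'
  have h2 := h.one_le_n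
  have : (2 : ℝ) ≤ d := by linarith
  exact_mod_cast this

/-- The failure probability in the concentration estimate is small. -/
lemma failure_le :
    ENNReal.ofReal (32 * n ^ 2 / ((d : ℝ) - 1) ^ 2) +
      ENNReal.ofReal (8 * n / (κ / 200 * ((d : ℝ) - 1)))
        + ENNReal.ofReal (32 / ((κ / 200) ^ 2 * ((d : ℝ) - 1))) ≤ ENNReal.ofReal (1 / 8) := by
  have h1 := h.large'
  have h2 := h.one_le_n
  have hκ := h.kappa_pos
  have hD : (d : ℝ) / 2 ≤ d - 1 := by linarith
  have hD0 : (0 : ℝ) < d - 1 := by linarith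
  have hDκ : 4 * 10 ^ 7 * (n : ℝ) ≤ κ ^ 2 * ((d : ℝ) - 1) := by
    have h3 : (d : ℝ) / 2 * κ ^ 2 ≤ (d - 1) * κ ^ 2 := by gcongr
    linarith [h.large]
  have hDκ1 : 10 ^ 7 * (n : ℝ) ≤ κ * ((d : ℝ) - 1) := by
    have h3 : κ ^ 2 * ((d : ℝ) - 1) ≤ κ * (d - 1) := by
      have : κ ^ 2 ≤ κ := by nlinarith [h.kappa_lt]
      gcongr
    linarith
  have hD7 : 10 ^ 7 * (n : ℝ) ≤ (d : ℝ) - 1 := by linarith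
  rw [← ENNReal.ofReal_add (by positivity) (by positivity),
    ← ENNReal.ofReal_add (by positivity) (by positivity)]
  apply ENNReal.ofReal_le_ofReal
  have e1 : 32 * (n : ℝ) ^ 2 / ((d : ℝ) - 1) ^ 2 ≤ 1 / 100 := by
    rw [div_le_div_iff₀ (by positivity) (by norm_num)]
    have : (10 ^ 7 * (n : ℝ)) ^ 2 ≤ ((d : ℝ) - 1) ^ 2 := pow_le_pow_left₀ (by positivity) hD7 2
    nlinarith
  have e2 : 8 * n / (κ / 200 * ((d : ℝ) - 1)) ≤ 1 / 100 := by
    rw [div_le_div_iff₀ (by positivity) (by norm_num)]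
    linarith
  have e3 : 32 / ((κ / 200) ^ 2 * ((d : ℝ) - 1)) ≤ 1 / 10 := by
    rw [div_le_div_iff₀ (by positivity) (by norm_num)]
    linarith
  linarith

/-- The hyperplane radius is close to `σ √d`. -/
lemma radius_bounds : (1 - κ / 400) * (n / κ) ≤ ((d : ℝ) - 1) * σ ^ 2 ∧
    ((d : ℝ) - 1) * σ ^ 2 ≤ n / κ := by
  have hκ := h.kappa_pos
  have h1 : (n : ℝ) / κ = d * σ ^ 2 := by
    rw [div_eq_iff hκ.ne', ← h.eq]; ring
  rw [h1]
  have h2 : 1 ≤ κ / 400 * d := by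
    have h3 := h.large
    have h4 := h.one_le_n
    have h5 : d * κ ^ 2 ≤ d * κ := by
      have : κ ^ 2 ≤ κ := by nlinarith [h.kappa_lt]
      gcongr
    linarith
  have h3 : 0 < σ ^ 2 := pow_pos h.sigma_pos 2
  constructor <;> nlinarith

/-- The signed sum controls the labelled mean from above, and the separator controls the maximum
margin from below. The accuracy must be relative of order `κ`, so that the error `√(2κ/50)` in the
components of `w` is a small multiple of `√κ`, the size of `⟪w, μ⟫` for small `κ`. -/
lemma mem_goodSamples (A : Sample n d → Feat d) {ε : ℝ} (hε : ε ≤ κ / 1000)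
    {μ : Feat d} (hμ : ‖μ‖ = 1) {y : Fin n → ℤˣ} {ξ : Fin n → Feat d}
    (hA : IsNearMaxMargin ε (A (mkSample μ y ξ)) (mkSample μ y ξ))
    (hξ : IsJunkOf μ (((d : ℝ) - 1) * σ ^ 2) ξ)
    (hV : ‖signedSum Finset.univ ξ y‖ ^ 2 ≤
      (1 + κ / 200 / 4) * (n * (((d : ℝ) - 1) * σ ^ 2)))
    (hW : HasJunkSeparator μ y ξ ((1 + κ / 200 / 2) * (n / (((d : ℝ) - 1) * σ ^ 2)))) :
    mkSample μ y ξ ∈ goodSamples A κ := by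
  have hκ := h.kappa_pos
  have hκ1 := h.kappa_lt
  have hn : (0 : ℝ) < n := by exact_mod_cast h.n_pos
  obtain ⟨hr1, hr2⟩ := h.radius_bounds
  set R2 := ((d : ℝ) - 1) * σ ^ 2 with hR2
  have hR0 : 0 < R2 := by
    have : 0 < (1 - κ / 400) * (n / κ) := mul_pos (by linarith) (by positivity)
    linarith
  have hT := marginScale_pos hκ
  have hTκ := marginScale_sq_mul hκ
  set T := marginScale κ with hTdef
  constructor
  · apply le_of_sq_le_sq_of_nonneg _ hT.le
    rw [norm_labelledMean_mkSample_sq h.n_pos hμ y fun i => (hξ i).1, marginScale_sq hκ]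
    have h1 : ‖signedSum Finset.univ ξ y‖ ^ 2 / n ^ 2 ≤
        (1 + κ / 200 / 4) * (n * (n / κ)) / n ^ 2 := by
      gcongr
      exact hV.trans (by gcongr)
    have h2 : (1 + κ / 200 / 4) * (n * (n / κ)) / n ^ 2 = (1 + κ / 200 / 4) / κ := by
      field_simp
    have h3 : (1 + κ / 200 / 4) / κ ≤ (1 + κ / 200) / κ := by
      apply div_le_div_of_nonneg_right _ hκ.le
      linarith
    linarith
  · refine le_trans ?_ hA.2
    have hmax := sqrt_le_maxMargin h.n_pos hμ (fun i => (hξ i).1) (by positivity) hW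
    have hlow : √((1 - κ / 200) * ((1 + κ) / κ)) ≤ maxMargin (mkSample μ y ξ) := by
      refine le_trans (Real.sqrt_le_sqrt ?_) hmax
      have h1 : ((1 + κ / 200 / 2) * (n / R2))⁻¹ = R2 / n / (1 + κ / 400) := by
        rw [mul_inv, inv_div]; field_simp; ring
      have h2 : (1 - κ / 400) / κ ≤ R2 / n := by
        rw [div_le_div_iff₀ hκ hn]
        have : (1 - κ / 400) * (n / κ) * κ ≤ R2 * κ := by gcongr
        have h4 : (1 - κ / 400) * (n / κ) * κ = (1 - κ / 400) * n := by field_simp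
        linarith
      have h3 : (1 - κ / 400) / κ / (1 + κ / 400) ≤ R2 / n / (1 + κ / 400) := by gcongr
      have h4 : (1 - κ / 200) / κ ≤ (1 - κ / 400) / κ / (1 + κ / 400) := by
        rw [div_div, div_le_div_iff₀ hκ (by positivity)]
        nlinarith [sq_nonneg κ, mul_pos hκ hκ, mul_pos (mul_pos hκ hκ) hκ]
      have h5 : (1 - κ / 200) * ((1 + κ) / κ) = (1 - κ / 200) / κ + (1 - κ / 200) := by
        field_simp
      rw [h1, h5]
      linarith
    have hε1 : 0 ≤ 1 - ε := by linarith
    refine le_trans ?_ (mul_le_mul_of_nonneg_left hlow hε1)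
    set Z := (1 - κ / 200) * ((1 + κ) / κ) with hZ
    have hZ0 : 0 ≤ Z := mul_nonneg (by linarith) (by positivity)
    apply le_of_sq_le_sq_of_nonneg _ (mul_nonneg hε1 (Real.sqrt_nonneg _))
    rw [mul_pow, mul_pow, Real.sq_sqrt hZ0]
    have hZκ : Z * κ = (1 - κ / 200) * (1 + κ) := by rw [hZ]; field_simp
    -- Multiplying by `κ` makes both sides polynomial; the slack `κ/50` absorbs the errors `κ/200`
    -- in `T`, `κ/200` in `Z` and `κ/1000` from `ε`.
    have key : (1 - κ / 50) ^ 2 * (T ^ 2 * κ) ≤ (1 - ε) ^ 2 * (Z * κ) := by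
      rw [hTκ, hZκ]
      have k1 : (1 - κ / 1000) ^ 2 ≤ (1 - ε) ^ 2 := pow_le_pow_left₀ (by linarith) (by linarith) 2
      have k2 : (1 - κ / 1000) ^ 2 * ((1 - κ / 200) * (1 + κ)) ≤
          (1 - ε) ^ 2 * ((1 - κ / 200) * (1 + κ)) :=
        mul_le_mul_of_nonneg_right k1 (mul_nonneg (by linarith) (by linarith))
      refine le_trans ?_ k2
      have k3 : (1 - κ / 50) ^ 2 * (1 + κ + κ / 200) ≤ (1 - κ / 50) * ((1 + κ / 200) * (1 + κ)) := by
        have : (1 - κ / 50) ^ 2 ≤ 1 - κ / 50 := by nlinarith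
        have h6 : 1 + κ + κ / 200 ≤ (1 + κ / 200) * (1 + κ) := by nlinarith
        exact mul_le_mul this h6 (by positivity) (by linarith)
      have k4 : (1 - κ / 50) * (1 + κ / 200) ≤ (1 - κ / 1000) ^ 2 * (1 - κ / 200) := by
        have h7 : 1 - κ / 500 ≤ (1 - κ / 1000) ^ 2 := by nlinarith
        have h8 : (1 - κ / 500) * (1 - κ / 200) ≤ (1 - κ / 1000) ^ 2 * (1 - κ / 200) :=
          mul_le_mul_of_nonneg_right h7 (by linarith)
        nlinarith
      have k5 := mul_le_mul_of_nonneg_right k4 (show 0 ≤ 1 + κ by linarith)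
      nlinarith
    have : (1 - κ / 50) ^ 2 * T ^ 2 * κ ≤ (1 - ε) ^ 2 * Z * κ := by linarith
    exact le_of_mul_le_mul_right this hκ

omit h in
lemma measurable_margin {Ω : Type*} [MeasurableSpace Ω] {w : Ω → Feat d} {S : Ω → Sample n d}
    (hw : Measurable w) (hS : Measurable S) : Measurable fun ω => margin (w ω) (S ω) := by
  unfold margin linPred
  refine Measurable.iInf fun i => ?_
  have h1 : Measurable fun ω => S ω i := (measurable_pi_apply i).comp hS
  exact (measurable_labelVal.comp h1.snd).mul (hw.inner h1.fst)

omit h in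
lemma measurableSet_goodSamples {A : Sample n d → Feat d} (hA : Measurable A) :
    MeasurableSet (goodSamples A κ) := by
  have h1 : Measurable fun S : Sample n d => labelledMean S := by
    unfold labelledMean
    refine Measurable.const_smul (M := ℝ) (Finset.measurable_fun_sum Finset.univ fun i _ => ?_) _
    have h1 : Measurable fun S : Sample n d => S i := measurable_pi_apply i
    exact (measurable_labelVal.comp h1.snd).smul h1.fst
  exact (measurableSet_le h1.norm measurable_const).inter
    (measurableSet_le measurable_const (measurable_margin hA measurable_id))

lemma sampleLaw_goodSamples_compl_le {A : Sample n d → Feat d} (hAm : Measurable A) {ε : ℝ}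
    (hε : ε ≤ κ / 1000) (hA : ∀ S, IsNearMaxMargin ε (A S) S) {μ : Feat d} (hμ : ‖μ‖ = 1) :
    sampleLaw n (linDist μ σ) (goodSamples A κ)ᶜ ≤ ENNReal.ofReal (1 / 8) := by
  have := isProbabilityMeasure_junkLaw μ hμ h.two_le_d σ
  have hm : Measurable fun p : (Fin n → ℤˣ) × (Fin n → Feat d) => mkSample μ p.1 p.2 :=
    measurable_mkSample measurable_const measurable_fst measurable_snd
  rw [sampleLaw_linDist, Measure.map_apply hm (measurableSet_goodSamples hAm).compl,
    Set.preimage_compl]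
  have hnd : 4 * (n : ℝ) ≤ (d : ℝ) - 1 := by
    have h1 := h.large'
    have h2 := h.one_le_n
    linarith
  exact (labels_junks_bad_le μ hμ h.two_le_d h.sigma_pos h.n_pos hnd
    (div_pos h.kappa_pos (by norm_num)) _ (hm (measurableSet_goodSamples hAm))
    fun y ξ hξ hV hW => h.mem_goodSamples A hε hμ (hA _) hξ hV hW).trans h.failure_le

end IsRegime

end GoodSamples

/-! ### Replacing the signal makes the margin bound fail. -/

section BadSamples

variable {d n : ℕ}

/-- The samples on which the margin bound fails. -/
def boundFails (n : ℕ) (H : Set (Feat d)) (p : ℕ) (G : ℝ) (D : Measure (Example d)) :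
    Set (Sample n d) :=
  {S | ∃ w ∈ H, 0 < margin w S ∧ G / margin w S ^ p ≤ testLoss D w - empLoss S w}

variable {H : Set (Feat d)} {p : ℕ} {G : ℝ}

/-- A positive margin means zero empirical loss, so the generalization gap is the whole test loss.
-/
lemma mem_boundFails {D : Measure (Example d)} {S : Sample n d} {w : Feat d} (hw : w ∈ H)
    {t : ℝ} (ht : 0 < t) (hm : t ≤ margin w S) {L : ℝ} (hL0 : 0 ≤ L) (hL : L ≤ testLoss D w)
    (hG : G ≤ L * t ^ p) : S ∈ boundFails n H p G D := by
  have hm0 : 0 < margin w S := ht.trans_le hm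
  refine ⟨w, hw, hm0, ?_⟩
  rw [empLoss_eq_zero hm0, sub_zero, div_le_iff₀ (by positivity)]
  calc G ≤ L * t ^ p := hG
    _ ≤ testLoss D w * margin w S ^ p :=
      mul_le_mul hL (pow_le_pow_left₀ ht.le hm p) (by positivity) (hL0.trans hL)

variable {σ κ : ℝ} (h : IsRegime n d σ κ) {A : Sample n d → Feat d}
  (hA : ∀ S, ‖A S‖ ≤ 1)
include h hA

/-- A sample with the opposite signal, and the same junk, makes the margin bound fail. -/
lemma IsRegime.mem_boundFails_neg (hκ3 : κ < 1 / 3) {μ : Feat d} (hμ : ‖μ‖ = 1)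
    {y : Fin n → ℤˣ} {ξ : Fin n → Feat d} (hξ : IsJunkOf μ (((d : ℝ) - 1) * σ ^ 2) ξ)
    (hgood : mkSample μ y ξ ∈ goodSamples A κ) (hH : A (mkSample μ y ξ) ∈ H)
    (hG : G ≤ (1 - Real.exp (-(κ / (36 * σ ^ 2)))) * ((1 - 3 * κ) * marginScale κ) ^ p) :
    mkSample (-μ) y ξ ∈ boundFails n H p G (linDist (-μ) σ) := by
  have hκ := h.kappa_pos
  have hT := marginScale_pos hκ
  have hTκ := marginScale_sq_mul hκ
  obtain ⟨hg1, hg2⟩ := hgood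
  set w := A (mkSample μ y ξ)
  set T := marginScale κ with hTdef
  have ha := abs_inner_sub_le h.n_pos (hA _) hμ.le hT hg1 hg2
  have hgμ : inner ℝ (labelledMean (mkSample μ y ξ)) μ = (1 : ℝ) := by
    rw [real_inner_comm, labelledMean_mkSample h.n_pos, inner_add_right, inner_smul_right,
      inner_signedSum_eq_zero fun i => (hξ i).1, real_inner_self_eq_norm_sq, hμ]
    norm_num
  -- So `⟪w, μ⟫` is within `√κ/5` of `1/T`. As `κ < 1/3` puts `1/T` between `5√κ/6` and `√κ`, it
  -- lies between `√κ/2` and `6√κ/5`.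
  rw [hgμ, show 2 * (κ / 50) = (1 / 5) ^ 2 * κ by ring, Real.sqrt_mul (by norm_num),
    Real.sqrt_sq (by norm_num), abs_le] at ha
  set s := √κ with hs
  have hs0 : 0 < s := Real.sqrt_pos.2 hκ
  have hs2 : s ^ 2 = κ := Real.sq_sqrt hκ.le
  have hw1 : ‖w‖ ≤ 1 := hA _
  set a : ℝ := inner ℝ w μ with hadef
  have hTs : 1 ≤ T * s := by
    have : (1 : ℝ) ^ 2 ≤ (T * s) ^ 2 := by rw [mul_pow, hs2, hTκ]; linarith
    exact le_of_sq_le_sq_of_nonneg this (by positivity)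
  have hTs2 : T * s ≤ 6 / 5 := by
    have : (T * s) ^ 2 ≤ (6 / 5) ^ 2 := by rw [mul_pow, hs2, hTκ]; linarith
    exact le_of_sq_le_sq_of_nonneg this (by positivity)
  have hinv1 : 5 / 6 * s ≤ 1 / T := by
    rw [le_div_iff₀ hT]; linarith
  have hinv2 : 1 / T ≤ s := by
    rw [div_le_iff₀ hT]; linarith
  have hinv3 : s ≤ κ * T := by
    rw [← hs2]; nlinarith
  have ha1 : s / 2 ≤ a := by linarith [ha.1]
  have ha0 : 0 < a := by linarith
  have ha2 : κ / 4 ≤ a ^ 2 := by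
    have : (s / 2) ^ 2 ≤ a ^ 2 := pow_le_pow_left₀ (by positivity) ha1 2
    rw [div_pow, hs2] at this
    linarith
  have ha3 : a ^ 2 ≤ 1 := by
    have : a ≤ 1 := (real_inner_le_norm _ _).trans (by rw [hμ, mul_one]; exact hw1)
    exact pow_le_one₀ ha0.le this
  have hrad : (2 : ℝ) ≤ ((d : ℝ) - 1) * σ ^ 2 := by
    refine le_trans ?_ h.radius_bounds.1
    have h1 : 3 ≤ (n : ℝ) / κ := by
      rw [le_div_iff₀ hκ]; linarith [h.one_le_n]
    nlinarith
  have hloss := testLoss_neg_ge μ hμ h.two_le_d h.sigma_pos w hw1 ha0 (by linarith)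
  have hσ2 : 0 < σ ^ 2 := pow_pos h.sigma_pos 2
  refine mem_boundFails hH (t := (1 - 3 * κ) * T) (mul_pos (by linarith) hT) ?_ ?_ ?_ hG
  · have h1 := margin_mkSample_sub_le h.n_pos w μ (-μ) y ξ
    rw [inner_neg_right] at h1
    refine le_trans ?_ h1
    -- Reversing the signal costs `2a ≤ 12κT/5`; with the initial deficit `κT/50` the loss stays
    -- below `3κT`.
    have h2 : a ≤ 6 / 5 * (κ * T) := by linarith [ha.2]
    change _ ≤ _ - a + -a
    nlinarith
  · rw [sub_nonneg, Real.exp_le_one_iff, neg_nonpos]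
    positivity
  · refine le_trans (sub_le_sub_left (Real.exp_le_exp.2 (neg_le_neg ?_)) _) hloss
    rw [div_le_div_iff₀ (by positivity) (by positivity)]
    nlinarith

/-- A sample whose signal is orthogonal to the original one, with the same junk, makes the margin
bound fail for one of the two orientations of the new signal. -/
lemma IsRegime.mem_boundFails_orthogonal (hp : 1 ≤ p) {m e : Feat d} (hm : ‖m‖ = 1) (he : ‖e‖ = 1)
    (hme : inner ℝ e m = 0) {y : Fin n → ℤˣ} {ξ : Fin n → Feat d}
    (hξ : ∀ i, inner ℝ m (ξ i) = 0) (hξe : ∀ i, inner ℝ e (ξ i) = 0)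
    (hgood : mkSample m y ξ ∈ goodSamples A κ) (hH : A (mkSample m y ξ) ∈ H)
    (hG : G ≤ (1 / 20 * marginScale κ) ^ p) :
    mkSample e y ξ ∈ boundFails n H p G (linDist e σ) ∨
      mkSample (-e) y ξ ∈ boundFails n H p G (linDist (-e) σ) := by
  have hκ := h.kappa_pos
  have hκ1 := h.kappa_lt
  have hT := marginScale_pos hκ
  have hTκ := marginScale_sq_mul hκ
  obtain ⟨hg1, hg2⟩ := hgood
  set w := A (mkSample m y ξ)
  set T := marginScale κ with hTdef
  have ha := abs_inner_sub_le h.n_pos (hA _) hm.le hT hg1 hg2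
  have hb := abs_inner_sub_le h.n_pos (hA _) he.le hT hg1 hg2
  have hgm : inner ℝ (labelledMean (mkSample m y ξ)) m = (1 : ℝ) := by
    rw [real_inner_comm, labelledMean_mkSample h.n_pos, inner_add_right, inner_smul_right,
      inner_signedSum_eq_zero hξ, real_inner_self_eq_norm_sq, hm]
    norm_num
  have hge : inner ℝ (labelledMean (mkSample m y ξ)) e = (0 : ℝ) := by
    rw [real_inner_comm, labelledMean_mkSample h.n_pos, inner_add_right, inner_smul_right,
      inner_signedSum_eq_zero hξe, hme]
    norm_num
  have hr : √(2 * (κ / 50)) ≤ 1 / 5 := by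
    rw [Real.sqrt_le_left (by norm_num)]; linarith
  rw [hgm, abs_le] at ha
  rw [hge, zero_div, sub_zero, abs_le] at hb
  set a : ℝ := inner ℝ w m with hadef
  set b : ℝ := inner ℝ w e with hbdef
  have hT2 : 2 ≤ T ^ 2 := by
    by_contra hcon
    push Not at hcon
    have : T ^ 2 * κ < 2 * κ := by gcongr
    linarith
  have hT14 : 7 / 5 ≤ T := by
    apply le_of_sq_le_sq_of_nonneg _ hT.le
    linarith
  have hinv : 1 / T ≤ T / 2 := by
    rw [div_le_div_iff₀ hT (by norm_num)]; nlinarith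
  have hhalf : ((1 : ℝ) / 2) ^ p ≤ 1 / 2 := pow_le_of_le_one (by norm_num) (by norm_num) (by omega)
  -- The factor `1/20` pays for both the margin `T/10` and the test loss `1/2`, since `2⁻ᵖ ≤ 1/2`
  -- for `p ≥ 1`.
  have hG' : G ≤ 1 / 2 * (T / 10) ^ p := by
    refine hG.trans ?_
    rw [show 1 / 20 * T = 1 / 2 * (T / 10) by ring, mul_pow]
    gcongr
  have key : ∀ e' : Feat d, ‖e'‖ = 1 → inner ℝ w e' ≤ 0 → -(1 / 5) ≤ (inner ℝ w e' : ℝ) →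
      mkSample e' y ξ ∈ boundFails n H p G (linDist e' σ) := by
    intro e' he' h0 h5
    have := isProbabilityMeasure_junkLaw e' he' h.two_le_d σ
    refine mem_boundFails hH (t := T / 10) (by positivity) ?_ (by norm_num)
      (half_le_testLoss e' w σ h0) hG'
    refine le_trans ?_ (margin_mkSample_sub_le h.n_pos w m e' y ξ)
    have h7 : 49 / 50 * T ≤ (1 - κ / 50) * T := by
      gcongr
      linarith
    change _ ≤ _ - a + _
    linarith [ha.2]
  rcases le_total b 0 with h0 | h0
  · exact Or.inl (key e he h0 (by linarith [hb.1]))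
  · refine Or.inr (key (-e) (by rwa [norm_neg]) ?_ ?_)
    · rw [inner_neg_right]; linarith
    · rw [inner_neg_right]; linarith [hb.2]

end BadSamples

/-! ### Haar measure on the compact group of linear isometries. -/

section Rotations

variable {d : ℕ}

/-- The group of linear isometries of the feature space. -/
noncomputable abbrev RotGroup (d : ℕ) : Type := ↥(unitary (Feat d →L[ℝ] Feat d))

instance : ContinuousStar (Feat d →L[ℝ] Feat d) :=
  ⟨(ContinuousLinearMap.adjoint : (Feat d →L[ℝ] Feat d) ≃ₗᵢ⋆[ℝ] _).continuous⟩

noncomputable instance : MeasurableSpace (RotGroup d) := borel _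

instance : BorelSpace (RotGroup d) := ⟨rfl⟩

instance : CompactSpace (RotGroup d) := by
  refine isCompact_iff_compactSpace.1 ?_
  refine Metric.isCompact_of_isClosed_isBounded isClosed_unitary ?_
  refine (Metric.isBounded_closedBall (x := (0 : Feat d →L[ℝ] Feat d)) (r := 1)).subset ?_
  intro u hu
  rw [mem_closedBall_zero_iff]
  exact ContinuousLinearMap.opNorm_le_bound _ zero_le_one fun x => by
    rw [one_mul, ContinuousLinearMap.norm_map_of_mem_unitary hu]

/-- The uniform law on the group of linear isometries. -/
noncomputable def rotLaw (d : ℕ) : Measure (RotGroup d) :=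
  Measure.haarMeasure ⊤

instance : IsProbabilityMeasure (rotLaw d) :=
  ⟨by
    have h := Measure.haarMeasure_self (K₀ := (⊤ : TopologicalSpace.PositiveCompacts (RotGroup d)))
    simpa [rotLaw] using h⟩

instance : (rotLaw d).IsMulLeftInvariant := by
  unfold rotLaw; infer_instance

/-- The isometry by which the inverse of a group element acts. -/
noncomputable def rotAct (Q : RotGroup d) : Feat d ≃ₗᵢ[ℝ] Feat d :=
  Unitary.linearIsometryEquiv Q⁻¹

/-- Acting through the inverse turns left translation in the group into precomposition, so left
invariance absorbs an isometry applied before the random rotation. -/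
lemma rotAct_symm_mul (P : Feat d ≃ₗᵢ[ℝ] Feat d) (Q : RotGroup d) (v : Feat d) :
    rotAct (Unitary.linearIsometryEquiv.symm P * Q) v = rotAct Q (P.symm v) := by
  rw [rotAct, mul_inv_rev, map_mul, map_inv _ (Unitary.linearIsometryEquiv.symm P),
    MulEquiv.apply_symm_apply]
  rfl

lemma continuous_rotAct : Continuous fun p : RotGroup d × Feat d => rotAct p.1 p.2 := by
  have h : Continuous fun p : RotGroup d × Feat d =>
      ((p.1⁻¹ : RotGroup d) : Feat d →L[ℝ] Feat d) :=
    continuous_subtype_val.comp continuous_fst.inv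
  exact h.clm_apply continuous_snd

lemma measurable_rotAct {Ω : Type*} [MeasurableSpace Ω] {Q : Ω → RotGroup d} {v : Ω → Feat d}
    (hQ : Measurable Q) (hv : Measurable v) : Measurable fun ω => rotAct (Q ω) (v ω) := by
  have h := continuous_rotAct.measurable.comp (hQ.prodMk hv)
  exact h

end Rotations

/-! ### Measurable choice of an orthogonal unit vector. -/

section OrthogonalSelection

variable {d n : ℕ}

/-- Taking the first nonzero entry of the list is a measurable choice. It is applied to the
residuals of the standard basis vectors, which cannot all vanish when the random span is proper. -/
lemma exists_measurable_ne_zero {Ω ι : Type*} [MeasurableSpace Ω] (r : ι → Ω → Feat d)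
    (hr : ∀ j, Measurable (r j)) (l : List ι) :
    ∃ v : Ω → Feat d, Measurable v ∧ ∀ ω, (v ω = 0 ∨ ∃ j, v ω = r j ω) ∧
      ((∃ j ∈ l, r j ω ≠ 0) → v ω ≠ 0) := by
  classical
  induction l with
  | nil => exact ⟨0, measurable_const, fun ω => by simp⟩
  | cons a l ih =>
    obtain ⟨v, hv, h⟩ := ih
    refine ⟨fun ω => if r a ω = 0 then v ω else r a ω,
      Measurable.ite (hr a (measurableSet_singleton 0)) hv (hr a), fun ω => ?_⟩
    by_cases h0 : r a ω = 0
    · simp only [h0, if_true, List.mem_cons]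
      refine ⟨(h ω).1, ?_⟩
      rintro ⟨j, rfl | hj, hne⟩
      · exact absurd h0 hne
      · exact (h ω).2 ⟨j, hj, hne⟩
    · simp only [h0, if_false]
      exact ⟨Or.inr ⟨a, rfl⟩, fun _ => h0⟩

/-- A unit vector orthogonal to fewer than `d` random vectors can be chosen measurably. -/
lemma exists_measurable_orthogonal {Ω : Type*} [MeasurableSpace Ω] {k : ℕ} (hk : k < d)
    (f : Ω → Fin k → Feat d) (hf : ∀ i, Measurable fun ω => f ω i) :
    ∃ e : Ω → Feat d, Measurable e ∧ ∀ ω, ‖e ω‖ = 1 ∧ ∀ i, inner ℝ (e ω) (f ω i) = 0 := by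
  classical
  set K : Ω → Submodule ℝ (Feat d) := fun ω =>
    Submodule.span ℝ (f ω '' (Finset.univ : Finset (Fin k))) with hK
  set b := EuclideanSpace.basisFun (Fin d) ℝ with hb
  obtain ⟨v, hv, h⟩ := exists_measurable_ne_zero
    (fun j ω => b j - (K ω).starProjection (b j))
    (fun j => measurable_const.sub
      (measurable_starProjection_span f hf Finset.univ _ measurable_const))
    (Finset.univ : Finset (Fin d)).toList
  have hv0 : ∀ ω, v ω ≠ 0 := by
    intro ω
    apply (h ω).2
    by_contra hcon
    push Not at hcon
    have hmem : ∀ j, b j ∈ K ω := fun j => by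
      have h1 := sub_eq_zero.1 (hcon j (by simp))
      rw [h1]
      exact Submodule.starProjection_apply_mem _ _
    have htop : K ω = ⊤ := by
      rw [eq_top_iff, ← b.toBasis.span_eq, Submodule.span_le]
      rintro _ ⟨j, rfl⟩
      simpa using hmem j
    have hr := finrank_span_finset_le_card (R := ℝ) (Finset.univ.image (f ω))
    rw [Finset.coe_image] at hr
    have hr2 : Module.finrank ℝ (K ω) ≤ k :=
      hr.trans (Finset.card_image_le.trans (by simp))
    rw [htop, finrank_top, finrank_euclideanSpace_fin] at hr2
    omega
  have horth : ∀ ω, ∀ z ∈ K ω, inner ℝ (v ω) z = 0 := by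
    intro ω z hz
    rcases (h ω).1 with h0 | ⟨j, hj⟩
    · exact absurd h0 (hv0 ω)
    · rw [hj]
      exact Submodule.starProjection_inner_eq_zero _ _ hz
  refine ⟨fun ω => ‖v ω‖⁻¹ • v ω, hv.norm.inv.smul hv, fun ω => ⟨?_, fun i => ?_⟩⟩
  · rw [norm_smul, norm_inv, norm_norm, inv_mul_cancel₀ (norm_ne_zero_iff.2 (hv0 ω))]
  · rw [inner_smul_left, horth ω _ (Submodule.subset_span ⟨i, by simp, rfl⟩), mul_zero]

end OrthogonalSelection

/-! ### Sample laws under rotation and reversal of the signal. -/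

section Equivariance

variable {d n : ℕ}

/-- The reflection in the hyperplane orthogonal to `μ` reverses `μ` and fixes almost every junk
vector. -/
lemma junkLaw_neg (μ : Feat d) (σ : ℝ) : junkLaw (-μ) σ = junkLaw μ σ := by
  set U := (Submodule.span ℝ {μ})ᗮ.reflection with hU
  have h1 : U μ = -μ := Submodule.reflection_mem_subspace_orthogonal_precomplement_eq_neg
    (Submodule.mem_span_singleton_self μ)
  rw [← h1, ← map_junkLaw]
  conv_rhs => rw [← Measure.map_id (μ := junkLaw μ σ)]
  apply Measure.map_congr
  filter_upwards [ae_junkLaw μ σ] with ξ hξ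
  exact Submodule.reflection_mem_subspace_eq_self
    (Submodule.mem_orthogonal_singleton_iff_inner_right.2 hξ.1)

lemma measurable_mkSample_map (m : Feat d) (U : Feat d ≃ₗᵢ[ℝ] Feat d) :
    Measurable fun q : (Fin n → ℤˣ) × (Fin n → Feat d) => mkSample m q.1 fun i => U (q.2 i) :=
  measurable_mkSample measurable_const measurable_fst (measurable_pi_lambda _ fun i =>
    U.continuous.measurable.comp ((measurable_pi_apply i).comp measurable_snd))

/-- The sample law for a rotated signal, in terms of rotated junk components. -/
lemma sampleLaw_linDist_rotate (μ : Feat d) (σ : ℝ) [IsProbabilityMeasure (junkLaw μ σ)]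
    (U : Feat d ≃ₗᵢ[ℝ] Feat d) :
    sampleLaw n (linDist (U μ) σ) = ((labelsLaw n).prod (junksLaw n μ σ)).map
      (fun q => mkSample (U μ) q.1 fun i => U (q.2 i)) := by
  have hU : IsProbabilityMeasure ((junkLaw μ σ).map U) :=
    Measure.isProbabilityMeasure_map U.continuous.aemeasurable
  have hU' : IsProbabilityMeasure (junkLaw (U μ) σ) := by rwa [← map_junkLaw]
  have hj : IsProbabilityMeasure (junksLaw n μ σ) := by unfold junksLaw; infer_instance
  have hm : Measurable fun ξ : Fin n → Feat d => fun i => U (ξ i) :=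
    measurable_pi_lambda _ fun i => U.continuous.measurable.comp (measurable_pi_apply i)
  have h1 : junksLaw n (U μ) σ = (junksLaw n μ σ).map fun ξ i => U (ξ i) := by
    rw [junksLaw, junksLaw, Measure.pi_map_pi fun _ => U.continuous.aemeasurable, map_junkLaw]
  rw [sampleLaw_linDist, h1]
  have h2 := Measure.map_prod_map (labelsLaw n) (junksLaw n μ σ) measurable_id hm
  rw [Measure.map_id] at h2
  rw [h2, Measure.map_map (measurable_mkSample measurable_const measurable_fst measurable_snd)
    (measurable_id.prodMap hm)]
  rfl

/-- The same for the opposite signal. -/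
lemma sampleLaw_linDist_neg_rotate (μ : Feat d) (σ : ℝ) [IsProbabilityMeasure (junkLaw μ σ)]
    (U : Feat d ≃ₗᵢ[ℝ] Feat d) :
    sampleLaw n (linDist (-(U μ)) σ) = ((labelsLaw n).prod (junksLaw n μ σ)).map
      (fun q => mkSample (-(U μ)) q.1 fun i => U (q.2 i)) := by
  have : IsProbabilityMeasure (junkLaw (-μ) σ) := by rwa [junkLaw_neg]
  have h := sampleLaw_linDist_rotate (n := n) (-μ) σ U
  rw [map_neg] at h
  rw [h, junksLaw, junksLaw, junkLaw_neg]

end Equivariance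

/-! ### The two couplings and the resulting lower bounds on `G`. -/

section Coupling

variable {d n : ℕ} {H : Set (Feat d)} {p : ℕ} {G : ℝ} {σ κ : ℝ}

/-- The samples of typical margin for which the algorithm outputs a member of the class. -/
def usefulGoodSamples (A : Sample n d → Feat d) (H : Set (Feat d)) (κ : ℝ) : Set (Sample n d) :=
  {S | A S ∈ H} ∩ goodSamples A κ

lemma IsRegime.sampleLaw_usefulGoodSamples_ge (h : IsRegime n d σ κ) {A : Sample n d → Feat d}
    (hAm : Measurable A) {ε : ℝ} (hε : ε ≤ κ / 1000) (hA : ∀ S, IsNearMaxMargin ε (A S) S)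
    (hH : IsUseful A H (linearClass σ d)) {μ : Feat d} (hμ : ‖μ‖ = 1) :
    5 / 8 ≤ sampleLaw n (linDist μ σ) (usefulGoodSamples A H κ) := by
  have h1 := hH _ ⟨μ, hμ, rfl⟩
  have h2 := h.sampleLaw_goodSamples_compl_le hAm hε hA hμ
  have h3 : sampleLaw n (linDist μ σ) {S | A S ∈ H} ≤
      sampleLaw n (linDist μ σ) (usefulGoodSamples A H κ) + ENNReal.ofReal (1 / 8) := by
    refine (measure_mono (t := usefulGoodSamples A H κ ∪ (goodSamples A κ)ᶜ) ?_).trans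
      ((measure_union_le _ _).trans (by gcongr))
    intro S hS
    by_cases hg : S ∈ goodSamples A κ
    · exact Or.inl ⟨hS, hg⟩
    · exact Or.inr hg
  have h4 := h1.trans h3
  have h5 : (3 / 4 : ENNReal) = 5 / 8 + ENNReal.ofReal (1 / 8) := by
    rw [show (3 / 4 : ENNReal) = ENNReal.ofReal (3 / 4) by
        rw [ENNReal.ofReal_div_of_pos (by norm_num)]; norm_num,
      show (5 / 8 : ENNReal) = ENNReal.ofReal (5 / 8) by
        rw [ENNReal.ofReal_div_of_pos (by norm_num)]; norm_num,
      ← ENNReal.ofReal_add (by norm_num) (by norm_num)]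
    norm_num
  rw [h5] at h4
  exact (ENNReal.add_le_add_iff_right ENNReal.ofReal_ne_top).1 h4

/-- If the margin bound holds, `G` is large in terms of the probability of misclassification. -/
lemma IsRegime.lt_of_isPolyMarginBound (h : IsRegime n d σ κ) {A : Sample n d → Feat d}
    (hAm : Measurable A) {ε : ℝ} (hε : ε ≤ κ / 1000) (hA : ∀ S, IsNearMaxMargin ε (A S) S)
    (hHm : MeasurableSet H) (hH : IsUseful A H (linearClass σ d))
    (hG : IsPolyMarginBound n H (linearClass σ d) p G) (hκ3 : κ < 1 / 3) {μ : Feat d}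
    (hμ : ‖μ‖ = 1) :
    (1 - Real.exp (-(κ / (36 * σ ^ 2)))) * ((1 - 3 * κ) * marginScale κ) ^ p < G := by
  by_contra hcon
  push Not at hcon
  have := isProbabilityMeasure_junkLaw μ hμ h.two_le_d σ
  have hU : MeasurableSet (usefulGoodSamples A H κ) :=
    (hAm hHm).inter (measurableSet_goodSamples hAm)
  have hm : ∀ m : Feat d, Measurable fun q : (Fin n → ℤˣ) × (Fin n → Feat d) =>
      mkSample m q.1 q.2 := fun m => measurable_mkSample measurable_const measurable_fst measurable_snd
  have h1 := h.sampleLaw_usefulGoodSamples_ge hAm hε hA hH hμ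
  rw [sampleLaw_linDist, Measure.map_apply (hm μ) hU] at h1
  have h2 := hG _ ⟨-μ, by rwa [norm_neg], rfl⟩
  have h3 := sampleLaw_linDist_neg_rotate (n := n) μ σ (LinearIsometryEquiv.refl ℝ (Feat d))
  simp only [LinearIsometryEquiv.coe_refl, id] at h3
  have h4 : ((labelsLaw n).prod (junksLaw n μ σ))
      ((fun q => mkSample μ q.1 q.2) ⁻¹' usefulGoodSamples A H κ) ≤ 1 / 4 := by
    refine le_trans ?_ h2
    rw [h3]
    -- The failure set need not be measurable; the inequality for outer measure holds for any set
    -- and is the direction needed.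
    refine le_trans (measure_mono_ae ?_) (Measure.le_map_apply (hm (-μ)).aemeasurable _)
    have hae : ∀ᵐ q ∂(labelsLaw n).prod (junksLaw n μ σ),
        IsJunkOf μ (((d : ℝ) - 1) * σ ^ 2) q.2 :=
      Measure.quasiMeasurePreserving_snd.ae (ae_isJunkOf μ hμ h.two_le_d σ)
    filter_upwards [hae] with q hq hmem
    exact h.mem_boundFails_neg (fun S => (hA S).1) hκ3 hμ hq hmem.2 hmem.1 hcon
  have h5 := h1.trans h4
  have : (5 / 8 : ENNReal).toReal ≤ (1 / 4 : ENNReal).toReal := ENNReal.toReal_mono (by simp) h5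
  norm_num at this

/-- If the margin bound holds, `G` is at least of the order of the power of the maximum margin. -/
lemma IsRegime.lt_of_isPolyMarginBound' (h : IsRegime n d σ κ) {A : Sample n d → Feat d}
    (hAm : Measurable A) {ε : ℝ} (hε : ε ≤ κ / 1000) (hA : ∀ S, IsNearMaxMargin ε (A S) S)
    (hHm : MeasurableSet H) (hH : IsUseful A H (linearClass σ d)) (hp : 1 ≤ p)
    (hG : IsPolyMarginBound n H (linearClass σ d) p G) {μ : Feat d} (hμ : ‖μ‖ = 1) :
    (1 / 20 * marginScale κ) ^ p < G := by
  by_contra hcon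
  push Not at hcon
  have := isProbabilityMeasure_junkLaw μ hμ h.two_le_d σ
  have hj : IsProbabilityMeasure (junksLaw n μ σ) := by unfold junksLaw; infer_instance
  have hU : MeasurableSet (usefulGoodSamples A H κ) :=
    (hAm hHm).inter (measurableSet_goodSamples hAm)
  set N := (labelsLaw n).prod (junksLaw n μ σ) with hN
  have hnd : n + 1 < d := by
    have h1 := h.large'
    have h2 := h.one_le_n
    have : (n : ℝ) + 1 < d := by linarith
    exact_mod_cast this
  -- The replacement signal must avoid `μ` and all `n` junk vectors, hence `n + 1 < d`; it depends
  -- on the junk, hence the measurable choice.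
  obtain ⟨e, hem, he⟩ := exists_measurable_orthogonal hnd
    (fun q : (Fin n → ℤˣ) × (Fin n → Feat d) => (Fin.cons μ q.2 : Fin (n + 1) → Feat d))
    (fun i => by
      refine Fin.cases ?_ (fun j => ?_) i
      · exact measurable_const
      · exact (measurable_pi_apply j).comp measurable_snd)
  have heμ : ∀ q, inner ℝ (e q) μ = 0 := fun q => by simpa using (he q).2 0
  have heξ : ∀ q i, inner ℝ (e q) (q.2 i) = 0 := fun q i => by simpa using (he q).2 i.succ
  set Y : RotGroup d → (Fin n → ℤˣ) × (Fin n → Feat d) → Feat d → Sample n d :=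
    fun Q q v => mkSample (rotAct Q v) q.1 fun i => rotAct Q (q.2 i) with hY
  have hYm : ∀ v : (Fin n → ℤˣ) × (Fin n → Feat d) → Feat d, Measurable v →
      Measurable fun x : RotGroup d × ((Fin n → ℤˣ) × (Fin n → Feat d)) =>
        Y x.1 x.2 (v x.2) := fun v hv =>
    measurable_mkSample (measurable_rotAct measurable_fst (hv.comp measurable_snd))
      (measurable_fst.comp measurable_snd) (measurable_pi_lambda _ fun i =>
        measurable_rotAct measurable_fst
          ((measurable_pi_apply i).comp (measurable_snd.comp measurable_snd)))
  set E1 : Set (RotGroup d × ((Fin n → ℤˣ) × (Fin n → Feat d))) :=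
    {x | Y x.1 x.2 μ ∈ usefulGoodSamples A H κ} with hE1
  set E2 : Set (RotGroup d × ((Fin n → ℤˣ) × (Fin n → Feat d))) :=
    {x | Y x.1 x.2 (e x.2) ∈ usefulGoodSamples A H κ} with hE2
  have hE1m : MeasurableSet E1 := hYm (fun _ => μ) measurable_const hU
  have hE2m : MeasurableSet E2 := hYm e hem hU
  have h1 : 5 / 8 ≤ ((rotLaw d).prod N) E1 := by
    rw [Measure.prod_apply hE1m]
    calc (5 / 8 : ENNReal) = ∫⁻ _, 5 / 8 ∂rotLaw d := by simp
      _ ≤ _ := by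
        apply lintegral_mono
        intro Q
        have h2 := h.sampleLaw_usefulGoodSamples_ge hAm hε hA hH (μ := rotAct Q μ)
          (by rw [LinearIsometryEquiv.norm_map, hμ])
        rwa [sampleLaw_linDist_rotate, Measure.map_apply (measurable_mkSample_map _ _) hU] at h2
  -- For fixed labels and junk, the reflection exchanging `e q` and `μ` fixes the junk, and Haar
  -- invariance absorbs it.
  have h12 : ((rotLaw d).prod N) E1 = ((rotLaw d).prod N) E2 := by
    rw [Measure.prod_apply_symm hE1m, Measure.prod_apply_symm hE2m]
    apply lintegral_congr_ae
    have hae : ∀ᵐ q ∂N, IsJunkOf μ (((d : ℝ) - 1) * σ ^ 2) q.2 :=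
      Measure.quasiMeasurePreserving_snd.ae (ae_isJunkOf μ hμ h.two_le_d σ)
    filter_upwards [hae] with q hq
    set P := (Submodule.span ℝ {e q - μ})ᗮ.reflection with hP
    have hPe : P (e q) = μ := Submodule.reflection_sub ((he q).1.trans hμ.symm)
    have hPs : P.symm = P := Submodule.reflection_symm
    have hPμ : P μ = e q := by
      rw [← hPe]; exact Submodule.reflection_reflection _ _
    have hPξ : ∀ i, P (q.2 i) = q.2 i := fun i => by
      apply Submodule.reflection_mem_subspace_eq_self
      rw [Submodule.mem_orthogonal_singleton_iff_inner_right, inner_sub_left, (hq i).1, heξ,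
        sub_zero]
    rw [← measure_preimage_mul (rotLaw d) (Unitary.linearIsometryEquiv.symm P)]
    congr 1
    ext Q
    simp only [hE1, hE2, hY, Set.mem_preimage, Set.mem_ofPred_eq, rotAct_symm_mul, hPs, hPμ, hPξ]
  have h3 : ((rotLaw d).prod N) E2 ≤ 1 / 2 := by
    rw [Measure.prod_apply hE2m]
    -- Now the roles are exchanged: the algorithm sees the signal `Q e`, while `±Q μ` is the
    -- replacement. The junk `Q ξ` has the correct law for both signals `±Q μ`, and the bound fails
    -- for one of them.
    have hQ : ∀ Q, N (Prod.mk Q ⁻¹' E2) ≤ 1 / 2 := by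
      intro Q
      have hn1 : ‖rotAct Q μ‖ = 1 := by rw [LinearIsometryEquiv.norm_map, hμ]
      have hb1 := hG _ ⟨rotAct Q μ, hn1, rfl⟩
      have hb2 := hG _ ⟨-(rotAct Q μ), by rwa [norm_neg], rfl⟩
      rw [sampleLaw_linDist_rotate] at hb1
      rw [sampleLaw_linDist_neg_rotate] at hb2
      have hc1 := (Measure.le_map_apply (measurable_mkSample_map (rotAct Q μ)
        (rotAct Q)).aemeasurable _).trans hb1
      have hc2 := (Measure.le_map_apply (measurable_mkSample_map (-(rotAct Q μ))
        (rotAct Q)).aemeasurable _).trans hb2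
      have h4 : (1 / 2 : ENNReal) = 1 / 4 + 1 / 4 := by
        rw [← ENNReal.toReal_eq_toReal_iff' (by simp) (by simp), ENNReal.toReal_add (by simp) (by simp)]
        norm_num
      rw [h4]
      refine le_trans (measure_mono_ae ?_) ((measure_union_le _ _).trans (add_le_add hc1 hc2))
      have hae : ∀ᵐ q ∂N, IsJunkOf μ (((d : ℝ) - 1) * σ ^ 2) q.2 :=
        Measure.quasiMeasurePreserving_snd.ae (ae_isJunkOf μ hμ h.two_le_d σ)
      filter_upwards [hae] with q hq hmem
      exact h.mem_boundFails_orthogonal (fun S => (hA S).1) hp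
        (by rw [LinearIsometryEquiv.norm_map, (he q).1]) hn1
        (by rw [LinearIsometryEquiv.inner_map_map, real_inner_comm, heμ])
        (fun i => by rw [LinearIsometryEquiv.inner_map_map, heξ])
        (fun i => by rw [LinearIsometryEquiv.inner_map_map, (hq i).1]) hmem.2 hmem.1 hcon
    calc _ ≤ ∫⁻ _, 1 / 2 ∂rotLaw d := lintegral_mono hQ
      _ = 1 / 2 := by simp
  have h5 := h1.trans (h12.le.trans h3)
  have : (5 / 8 : ENNReal).toReal ≤ (1 / 2 : ENNReal).toReal := ENNReal.toReal_mono (by simp) h5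
  norm_num at this

end Coupling

/-! ### Choice of the constant and conclusion. -/

section Main

variable {d n : ℕ} {H : Set (Feat d)} {p : ℕ} {G : ℝ} {σ κ : ℝ}

lemma isRegime_of_le (hσ : 0 < σ) (hκ : κ = (n : ℝ) / ((d : ℝ) * σ ^ 2)) (h0 : 0 < κ) (h1 : κ < 1)
    (hd : 10 ^ 8 / (κ ^ 2 * (1 - κ) ^ 4) ≤ (d : ℝ) / (n : ℝ)) : IsRegime n d σ κ := by
  have hn : n ≠ 0 := by
    rintro rfl
    simp [hκ] at h0
  have hd0 : d ≠ 0 := by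
    rintro rfl
    simp [hκ] at h0
  have hn' : (0 : ℝ) < n := by exact_mod_cast Nat.pos_of_ne_zero hn
  have hd' : (0 : ℝ) < d := by exact_mod_cast Nat.pos_of_ne_zero hd0
  have hκ1 : 0 < 1 - κ := by linarith
  refine ⟨Nat.pos_of_ne_zero hn, hσ, h0, h1, ?_, ?_⟩
  · rw [hκ]; field_simp
  · rw [div_le_div_iff₀ (by positivity) hn'] at hd
    refine hd.trans ?_
    have : (1 - κ) ^ 4 ≤ 1 := pow_le_one₀ hκ1.le (by linarith)
    rw [← mul_assoc]
    exact mul_le_of_le_one_right (by positivity) this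

lemma IsRegime.max_pow_mul_le (h : IsRegime n d σ κ) {A : Sample n d → Feat d}
    (hAm : Measurable A) {ε : ℝ} (hε : ε ≤ κ / 1000) (hA : ∀ S, IsNearMaxMargin ε (A S) S)
    (hHm : MeasurableSet H) (hH : IsUseful A H (linearClass σ d)) (hp : 1 ≤ p)
    (hG : IsPolyMarginBound n H (linearClass σ d) p G) {μ : Feat d} (hμ : ‖μ‖ = 1) :
    (max (1 / 10 ^ 8) (1 - Real.exp (-(κ / (36 * σ ^ 2))) - Real.exp (-((n : ℝ) / 8)) - 3 * κ)) ^ p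
      * marginScale κ ^ p ≤ G := by
  have hκ := h.kappa_pos
  have hT := marginScale_pos hκ
  rw [← mul_pow]
  set L := 1 - Real.exp (-(κ / (36 * σ ^ 2))) with hL
  have hn0 := Real.exp_pos (-((n : ℝ) / 8))
  rcases le_total (L - Real.exp (-((n : ℝ) / 8)) - 3 * κ) (1 / 10 ^ 8) with hcase | hcase
  · rw [max_eq_left hcase]
    refine le_trans ?_ (h.lt_of_isPolyMarginBound' hAm hε hA hHm hH hp hG hμ).le
    gcongr
    norm_num
  · rw [max_eq_right hcase]
    have hL1 : L ≤ 1 := by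
      have := Real.exp_pos (-(κ / (36 * σ ^ 2)))
      linarith
    have hκ3 : κ < 1 / 3 := by
      have : (0 : ℝ) < 1 / 10 ^ 8 := by norm_num
      linarith
    have hL0 : 0 ≤ L := by
      have : (0 : ℝ) < 1 / 10 ^ 8 := by norm_num
      linarith
    refine le_trans ?_ (h.lt_of_isPolyMarginBound hAm hε hA hHm hH hG hκ3 hμ).le
    -- Since `L ≤ 1`, already `L - 3κ ≤ L (1 - 3κ)`; the term `exp(-n/8)` is pure slack. Below, `L ^
    -- p ≤ L` converts the single test loss factor into a `p`-th power.
    have h1 : L - Real.exp (-((n : ℝ) / 8)) - 3 * κ ≤ L * (1 - 3 * κ) := by nlinarith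
    have h2 : 0 ≤ L - Real.exp (-((n : ℝ) / 8)) - 3 * κ := le_trans (by norm_num) hcase
    have h3 : 0 ≤ (1 - 3 * κ) * marginScale κ := mul_nonneg (by linarith) hT.le
    calc ((L - Real.exp (-((n : ℝ) / 8)) - 3 * κ) * marginScale κ) ^ p
        ≤ (L * (1 - 3 * κ) * marginScale κ) ^ p := by gcongr
      _ = L ^ p * ((1 - 3 * κ) * marginScale κ) ^ p := by rw [mul_assoc, mul_pow]
      _ ≤ L * ((1 - 3 * κ) * marginScale κ) ^ p :=
        mul_le_mul_of_nonneg_right (pow_le_of_le_one hL0 hL1 (by omega)) (pow_nonneg h3 p)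

end Main

theorem theorem5 :
    ∃ c : ℝ, 0 < c ∧
      ∀ (n d : ℕ) (σ κ : ℝ), 0 < σ → κ = (n : ℝ) / ((d : ℝ) * σ ^ 2) → 0 < κ → κ < 1 →
        c / (κ ^ 2 * (1 - κ) ^ 4) ≤ (d : ℝ) / (n : ℝ) →
        ∀ A : Sample n d → Feat d, Measurable A →
          (∀ S, IsNearMaxMargin (κ * (1 - κ) ^ 2 / c) (A S) S) →
          ∀ H : Set (Feat d), MeasurableSet H → IsUseful A H (linearClass σ d) →
            ∀ (p : ℕ) (G : ℝ), 1 ≤ p → IsPolyMarginBound n H (linearClass σ d) p G →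
              ∀ D ∈ linearClass σ d,
                ENNReal.ofReal (1 / 2 - 3 * Real.exp (-(n : ℝ))) ≤
                  sampleLaw n D
                    {S | (max (1 / c)
                          (1 - Real.exp (-(κ / (36 * σ ^ 2))) - Real.exp (-((n : ℝ) / 8))
                            - 3 * κ)) ^ p
                        ≤ G / maxMargin S ^ p} := by
  refine ⟨10 ^ 8, by norm_num, ?_⟩
  intro n d σ κ hσ hκ h0 h1 hd A hAm hA H hHm hH p G hp hG D hD
  have h := isRegime_of_le hσ hκ h0 h1 hd
  have hε : κ * (1 - κ) ^ 2 / 10 ^ 8 ≤ κ / 1000 := by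
    have h2 : (1 - κ) ^ 2 ≤ 1 := pow_le_one₀ (by linarith) (by linarith)
    have h3 : κ * (1 - κ) ^ 2 ≤ κ := mul_le_of_le_one_right h0.le h2
    linarith
  obtain ⟨μ, hμ, rfl⟩ := hD
  have hT := marginScale_pos h0
  have hmain := h.max_pow_mul_le hAm hε hA hHm hH hp hG hμ
  -- The probability obtained is `5/8`, more than claimed.
  calc ENNReal.ofReal (1 / 2 - 3 * Real.exp (-(n : ℝ))) ≤ ENNReal.ofReal (5 / 8) := by
        apply ENNReal.ofReal_le_ofReal
        have := Real.exp_pos (-(n : ℝ))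
        linarith
    _ = 5 / 8 := by rw [ENNReal.ofReal_div_of_pos (by norm_num)]; norm_num
    _ ≤ sampleLaw n (linDist μ σ) (usefulGoodSamples A H κ) :=
        h.sampleLaw_usefulGoodSamples_ge hAm hε hA hH hμ
    _ ≤ _ := by
        apply measure_mono
        rintro S ⟨-, hS1, hS2⟩
        have hpos : 0 < maxMargin S :=
          lt_of_lt_of_le (mul_pos (by linarith) hT)
            (hS2.trans (margin_le_maxMargin h.n_pos (hA S).1 S))
        have hle : maxMargin S ≤ marginScale κ := (maxMargin_le h.n_pos S).trans hS1
        simp only [Set.mem_ofPred_eq]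
        rw [le_div_iff₀ (pow_pos hpos p)]
        refine le_trans ?_ hmain
        gcongr
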